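/- All graphs are finite, simple and undirected. In a connected graph $G$, an edge $e$ is monitored by a pair of vertices $\{x,y\}$ if $e$ lies on every shortest path from $x$ to $y$; a set $M \subseteq V(G)$ is a monitoring edge-geodetic set (MEG-set) of $G$ if every edge of $G$ is monitored by some pair of vertices of $M$. The MEG-set Optimization Problem asks, given a connected graph $G$, for a MEG-set of $G$ of minimum size. The Vertex Cover Optimization Problem asks, given a graph $H$, for a minimum-size set of vertices that meets every edge of $H$. For a real number $\rho$, a polynomial-time $\rho$-approximation algorithm for one of these problems is a deterministic algorithm (Turing machine) that, on every input graph (encoded by its adjacency matrix), outputs in time polynomial in the length of the input a feasible solution whose size is at most $\rho$ times the minimum size of a feasible solution. Theorem. Let $r > 1$ be a real constant and suppose that there is a polynomial-time $r$-approximation algorithm for the MEG-set Optimization Problem. Then for every real constant $\varepsilon > 0$ there is a polynomial-time $(r+\varepsilon)$-approximation algorithm for the Vertex Cover Optimization Problem. -/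

import Mathlib

namespace MEG

/-- `{u, v}` is monitored by the pair `{x, y}`: it lies on all shortest paths from `x` to `y`.
(A walk from `x` to `y` of length `G.dist x y` is exactly a shortest path, as the graphs
considered for this notion are connected.) -/
def Monitors {V : Type} (G : SimpleGraph V) (x y u v : V) : Prop :=
  ∀ p : G.Walk x y, p.length = G.dist x y → s(u, v) ∈ p.edges

/-- `M` is a monitoring edge-geodetic set of `G`: every edge of `G` is monitored by a pair of
vertices of `M`. (A pair with `x = y` monitors no edge, since the empty path is shortest.) -/
def IsMEGSet {V : Type} (G : SimpleGraph V) (M : Set V) : Prop :=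
  ∀ u v : V, G.Adj u v → ∃ x ∈ M, ∃ y ∈ M, Monitors G x y u v

/-- Finite simple undirected graphs, with vertices numbered `0, …, order - 1`. -/
structure FiniteGraph where
  order : ℕ
  graph : SimpleGraph (Fin order)

/-- A minimization problem on graphs whose feasible solutions are sets of vertices and whose
objective function is the number of vertices. `IsInput` singles out the graphs that are inputs. -/
structure MinVertexSetProblem where
  IsInput : FiniteGraph → Prop
  IsFeasible : (G : FiniteGraph) → Finset (Fin G.order) → Prop

/-- The type of inputs of a problem. -/
abbrev MinVertexSetProblem.Input (P : MinVertexSetProblem) : Type :=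
  {G : FiniteGraph // P.IsInput G}

/-- The size of an optimal solution. -/
noncomputable def MinVertexSetProblem.opt (P : MinVertexSetProblem) (G : FiniteGraph) : ℕ :=
  sInf {k : ℕ | ∃ S : Finset (Fin G.order), P.IsFeasible G S ∧ S.card = k}

/-- The MEG-set optimization problem, on connected graphs. -/
def megSetProblem : MinVertexSetProblem where
  IsInput G := G.graph.Connected
  IsFeasible G M := IsMEGSet G.graph (M : Set (Fin G.order))

/-- The vertex cover optimization problem, on all finite graphs. -/
def vertexCoverProblem : MinVertexSetProblem where
  IsInput _ := True
  IsFeasible G C := G.graph.IsVertexCover (C : Set (Fin G.order))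

open Classical in
/-- Binary encoding of a graph on `n` vertices: the number `n` in unary, closed by `false`,
and then the `n × n` adjacency matrix, row by row. -/
noncomputable def encodeGraph (G : FiniteGraph) : List Bool :=
  List.replicate G.order true ++ false ::
    (List.finRange G.order).flatMap fun i =>
      (List.finRange G.order).map fun j => decide (G.graph.Adj i j)

/-- Binary encoding of a set of vertices: its characteristic vector. -/
def encodeVertexSet {n : ℕ} (S : Finset (Fin n)) : List Bool :=
  (List.finRange n).map fun i => decide (i ∈ S)

/-- `A` is a polynomial-time `r`-approximation algorithm for `P`: on (encoded) inputs of `P` it is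
computed by a Turing machine in time polynomial in the length of the encoding, its outputs are
feasible, and their size is at most `r` times the optimum. -/
structure IsPolyTimeApproxAlgorithm (P : MinVertexSetProblem) (r : ℝ)
    (A : (G : P.Input) → Finset (Fin G.val.order)) : Prop where
  polyTime : Nonempty (Turing.TM2ComputableInPolyTime
    (fun G : P.Input => encodeGraph G.val) (id : List Bool → List Bool)
    (fun G : P.Input => encodeVertexSet (A G)))
  feasible : ∀ G : P.Input, P.IsFeasible G.val (A G)
  ratio : ∀ G : P.Input, ((A G).card : ℝ) ≤ r * (P.opt G.val : ℝ)

end MEG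

/-!
The theorem is proved by an approximation-preserving reduction from vertex cover to MEG-sets,
followed by the construction of the machines that carry it out.

*The reduction.* Let `H` be a graph on `n` vertices and `t = C * (n + 1)` for a large constant `C`.
The graph `gridGraph H t` consists of `t ^ 2` copies of `H`, indexed by pairs `(i, j)`, together
with row vertices `(v, j)` adjacent to all copies `(v, i, j)` and a clique of hubs `i` adjacent to
all copies `(v, i, j)`. Hubs and rows monitor every edge outside the copies of `H`, and
a copy of `u` together with the row of `v` monitors the copy of an edge `uv`; so vertex covers of
the copies extend to MEG-sets by adding all `n * t + t = t ^ 2 / C` rows and hubs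
(`isMEGSet_gridGraph`). Conversely, a shortest path running through a copy of `uv` and neither
starting nor ending with it can be rerouted locally through a hub or another copy
(`exists_walk_avoiding`, `eq_or_eq_of_monitors`), so every MEG-set contains a vertex cover in each
of the copies (`isVertexCover_of_isMEGSet`). Reading off a copy that contains at most the average
number of vertices turns an `r`-approximate MEG-set into a vertex cover of size at most
`r * (opt + 1 / C)` (`card_coverOf_le`).

*The machines.* Both the adjacency matrix of the grid graph and the cover read off from a MEG-set
are lists whose length and entries are given by arithmetic expressions in the length and the bits
of the input, built with addition, truncated subtraction and bounded sums (`Arith`); product,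
quotient, remainder and minimization are derived from these. The values of such expressions are
polynomially bounded, so that register programs on the stacks of a `TM2` machine evaluate them in
unary in polynomial time (`Arith.exists_program`, `Arith.nonempty_polyTime`). The three
computations (reduction, MEG-set, cover) are chained by composing machines
(`TM2ComputableInPolyTime.nonempty_comp`).
-/

/-! ### Structured programs for multi-stack machines -/

namespace Turing

open TM2

/-- A program of a multi-stack machine: a finite control-flow graph of `TM2` statements with an
entry label. A program ends by executing `halt`; combinators replace `halt` by a jump. -/
structure StackProgram {K : Type} (Γ : K → Type) (σ : Type) where
  Λ : Type
  [fin : Fintype Λ]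
  entry : Λ
  code : Λ → Stmt Γ Λ σ

attribute [instance] StackProgram.fin

section Reach

variable {K : Type} [DecidableEq K] {Γ : K → Type} {Λ σ : Type}

/-- `c'` is reached from `c` in at most `n` steps. -/
def ReachIn (m : Λ → Stmt Γ Λ σ) (c c' : Cfg Γ Λ σ) (n : ℕ) : Prop :=
  ∃ k ≤ n, (flip bind (TM2.step m))^[k] (some c) = some c'

theorem ReachIn.mono {m : Λ → Stmt Γ Λ σ} {c c' : Cfg Γ Λ σ} {n n' : ℕ} (h : ReachIn m c c' n)
    (hn : n ≤ n') : ReachIn m c c' n' := by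
  obtain ⟨k, hk, e⟩ := h
  exact ⟨k, hk.trans hn, e⟩

theorem ReachIn.trans {m : Λ → Stmt Γ Λ σ} {c₁ c₂ c₃ : Cfg Γ Λ σ} {n₁ n₂ : ℕ}
    (h₁ : ReachIn m c₁ c₂ n₁) (h₂ : ReachIn m c₂ c₃ n₂) : ReachIn m c₁ c₃ (n₁ + n₂) := by
  obtain ⟨k₁, hk₁, e₁⟩ := h₁
  obtain ⟨k₂, hk₂, e₂⟩ := h₂
  refine ⟨k₂ + k₁, by omega, ?_⟩
  rw [Function.iterate_add_apply, e₁, e₂]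

theorem ReachIn.single (m : Λ → Stmt Γ Λ σ) (l : Λ) (v : σ) (S : ∀ k, List (Γ k)) :
    ReachIn m ⟨some l, v, S⟩ (stepAux (m l) v S) 1 :=
  ⟨1, le_rfl, rfl⟩

/-- A halted machine stays halted. -/
theorem iterate_step_none (m : Λ → Stmt Γ Λ σ) (k : ℕ) :
    (flip bind (TM2.step m))^[k] none = none := by
  induction k with
  | zero => rfl
  | succ k ih => rw [Function.iterate_succ_apply]; exact ih

/-- Step-by-step simulation transfers reachability with its time bound. -/
theorem ReachIn.simulate {K' : Type} [DecidableEq K'] {Γ' : K' → Type} {Λ' σ' : Type}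
    {m : Λ → Stmt Γ Λ σ} {m' : Λ' → Stmt Γ' Λ' σ'} (R : Cfg Γ Λ σ → Cfg Γ' Λ' σ' → Prop)
    (hR : ∀ l v S c', R ⟨some l, v, S⟩ c' →
      ∃ d', TM2.step m' c' = some d' ∧ R (stepAux (m l) v S) d')
    {c d : Cfg Γ Λ σ} {n : ℕ} (h : ReachIn m c d n) {c' : Cfg Γ' Λ' σ'} (hc : R c c') :
    ∃ d', ReachIn m' c' d' n ∧ R d d' := by
  obtain ⟨k, hk, e⟩ := h
  suffices H : ∀ k c c', R c c' → (flip bind (TM2.step m))^[k] (some c) = some d →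
      ∃ d', (flip bind (TM2.step m'))^[k] (some c') = some d' ∧ R d d' by
    obtain ⟨d', h₁, h₂⟩ := H k c c' hc e
    exact ⟨d', ⟨k, hk, h₁⟩, h₂⟩
  intro k
  induction k with
  | zero =>
    intro c c' hc e
    obtain rfl : c = d := Option.some.inj e
    exact ⟨c', rfl, hc⟩
  | succ k ih =>
    rintro ⟨l, v, S⟩ c' hc e
    rw [Function.iterate_succ_apply] at e
    cases l with
    | none => exact absurd ((iterate_step_none m k).symm.trans e) (by simp)
    | some l =>
      obtain ⟨d₁, h₁, h₂⟩ := hR l v S c' hc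
      obtain ⟨d', h₃, h₄⟩ := ih _ d₁ h₂ e
      refine ⟨d', ?_, h₄⟩
      rw [Function.iterate_succ_apply]
      rw [← h₃, ← h₁]
      rfl

end Reach

namespace TM2.Stmt

/-- The statement with labels renamed by `f` and `halt` replaced by a jump to `e`
(by `halt` if `e = none`). -/
def relabel {K : Type} {Γ : K → Type} {Λ Λ' σ : Type} (f : Λ → Λ') (e : Option Λ') :
    Stmt Γ Λ σ → Stmt Γ Λ' σ
  | push k g q => push k g (relabel f e q)
  | peek k g q => peek k g (relabel f e q)
  | pop k g q => pop k g (relabel f e q)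
  | load g q => load g (relabel f e q)
  | branch g q₁ q₂ => branch g (relabel f e q₁) (relabel f e q₂)
  | goto g => goto (fun v => f (g v))
  | halt => e.elim halt (fun l => goto (fun _ => l))

theorem stepAux_relabel {K : Type} [DecidableEq K] {Γ : K → Type} {Λ Λ' σ : Type} (f : Λ → Λ')
    (e : Option Λ') (q : Stmt Γ Λ σ) (v : σ) (S : ∀ k, List (Γ k)) :
    stepAux (relabel f e q) v S =
      ⟨(stepAux q v S).l.elim e (fun l => some (f l)), (stepAux q v S).var,
        (stepAux q v S).stk⟩ := by
  induction q generalizing v S with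
  | push k g q ih => simp only [relabel, stepAux, ih]
  | peek k g q ih => simp only [relabel, stepAux, ih]
  | pop k g q ih => simp only [relabel, stepAux, ih]
  | load g q ih => simp only [relabel, stepAux, ih]
  | branch g q₁ q₂ ih₁ ih₂ => cases h : g v <;> simp [relabel, stepAux, ih₁, ih₂, h]
  | goto g => simp [relabel]
  | halt => cases e <;> simp [relabel]

/-- The statement acting on a larger machine: its stacks are the stacks `i k`, and its internal
state is the component of the internal state given by `get` and `set`. -/
def lift {K K' : Type} {Γ : K' → Type} {Λ σ σ' : Type} (i : K → K') (get : σ' → σ)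
    (set : σ → σ' → σ') : Stmt (fun k => Γ (i k)) Λ σ → Stmt Γ Λ σ'
  | push k g q => push (i k) (fun v => g (get v)) (lift i get set q)
  | peek k g q => peek (i k) (fun v o => set (g (get v) o) v) (lift i get set q)
  | pop k g q => pop (i k) (fun v o => set (g (get v) o) v) (lift i get set q)
  | load g q => load (fun v => set (g (get v)) v) (lift i get set q)
  | branch g q₁ q₂ => branch (fun v => g (get v)) (lift i get set q₁) (lift i get set q₂)
  | goto g => goto (fun v => g (get v))
  | halt => halt

/-- The correspondence between configurations of a machine and of a larger machine extending the
internal state `w₀` and the stacks `T₀`. -/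
structure LiftRel {K K' : Type} {Γ : K' → Type} {Λ σ σ' : Type} (i : K → K')
    (set : σ → σ' → σ') (w₀ : σ') (T₀ : ∀ k, List (Γ k))
    (c : Cfg (fun k => Γ (i k)) Λ σ) (c' : Cfg Γ Λ σ') : Prop where
  l : c'.l = c.l
  var : c'.var = set c.var w₀
  stk : ∀ k, c'.stk (i k) = c.stk k
  stk_of_notMem : ∀ k, k ∉ Set.range i → c'.stk k = T₀ k

theorem stepAux_lift {K K' : Type} [DecidableEq K] [DecidableEq K'] {Γ : K' → Type}
    {Λ σ σ' : Type} {i : K → K'} (hi : Function.Injective i) {get : σ' → σ} {set : σ → σ' → σ'}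
    (get_set : ∀ a v, get (set a v) = a) (set_set : ∀ a b v, set a (set b v) = set a v)
    (w₀ : σ') (T₀ : ∀ k, List (Γ k)) (q : Stmt (fun k => Γ (i k)) Λ σ) (v : σ)
    (S : ∀ k, List (Γ (i k))) (T : ∀ k, List (Γ k)) (hST : ∀ k, T (i k) = S k)
    (hT : ∀ k, k ∉ Set.range i → T k = T₀ k) :
    LiftRel i set w₀ T₀ (stepAux q v S) (stepAux (lift i get set q) (set v w₀) T) := by
  have upd : ∀ (S : ∀ k, List (Γ (i k))) (T : ∀ k, List (Γ k)), (∀ k, T (i k) = S k) →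
      ∀ k₁ (x : List (Γ (i k₁))) k,
      Function.update T (i k₁) x (i k) = Function.update S k₁ x k := by
    intro S T h k₁ x k
    by_cases hk : k = k₁
    · subst hk; simp
    · rw [Function.update_of_ne hk, Function.update_of_ne (fun h' => hk (hi h')), h]
  have upd' : ∀ (T : ∀ k, List (Γ k)), (∀ k, k ∉ Set.range i → T k = T₀ k) →
      ∀ k₁ (x : List (Γ (i k₁))) k, k ∉ Set.range i → Function.update T (i k₁) x k = T₀ k := by
    intro T h k₁ x k hk
    rw [Function.update_of_ne (fun h' => hk ⟨k₁, h'.symm⟩), h k hk]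
  induction q generalizing v S T with
  | push k g q ih =>
    simp only [lift, stepAux, get_set, hST]
    exact ih _ _ _ (upd S T hST k _) (upd' T hT k _)
  | peek k g q ih =>
    simp only [lift, stepAux, get_set, set_set, hST]
    exact ih _ _ _ hST hT
  | pop k g q ih =>
    simp only [lift, stepAux, get_set, set_set, hST]
    exact ih _ _ _ (upd S T hST k _) (upd' T hT k _)
  | load g q ih =>
    simp only [lift, stepAux, get_set, set_set]
    exact ih _ _ _ hST hT
  | branch g q₁ q₂ ih₁ ih₂ =>
    simp only [lift, stepAux, get_set]
    cases g v
    · exact ih₂ _ _ _ hST hT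
    · exact ih₁ _ _ _ hST hT
  | goto g => exact ⟨by simp [lift, get_set], rfl, hST, hT⟩
  | halt => exact ⟨rfl, rfl, hST, hT⟩

end TM2.Stmt

namespace StackProgram

variable {K : Type} [DecidableEq K] {Γ : K → Type} {σ : Type}

/-- Started with internal state `v` and stacks `S`, the program halts with internal state `v'`
and stacks `S'` in at most `n` steps. -/
def Runs (F : StackProgram Γ σ) (v : σ) (S : ∀ k, List (Γ k)) (v' : σ) (S' : ∀ k, List (Γ k))
    (n : ℕ) : Prop :=
  ReachIn F.code ⟨some F.entry, v, S⟩ ⟨none, v', S'⟩ n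

theorem Runs.mono {F : StackProgram Γ σ} {v v' : σ} {S S' : ∀ k, List (Γ k)} {n n' : ℕ}
    (h : F.Runs v S v' S' n) (hn : n ≤ n') : F.Runs v S v' S' n' :=
  ReachIn.mono h hn

theorem Runs.congr {F : StackProgram Γ σ} {v v' v'' : σ} {S S' S'' : ∀ k, List (Γ k)} {n n' : ℕ}
    (h : F.Runs v S v' S' n) (hv : v' = v'') (hS : S' = S'') (hn : n ≤ n') :
    F.Runs v S v'' S'' n' := by
  subst hv hS
  exact h.mono hn

theorem Runs.relabel {F : StackProgram Γ σ} {v v' : σ} {S S' : ∀ k, List (Γ k)} {n : ℕ}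
    (h : F.Runs v S v' S' n) {Λ : Type} {m : Λ → Stmt Γ Λ σ} (f : F.Λ → Λ) (e : Option Λ)
    (hm : ∀ l, m (f l) = (F.code l).relabel f e) :
    ReachIn m ⟨some (f F.entry), v, S⟩ ⟨e, v', S'⟩ n := by
  obtain ⟨d', h₁, h₂⟩ := ReachIn.simulate
    (fun c c' => c' = ⟨c.l.elim e (fun l => some (f l)), c.var, c.stk⟩) (m' := m)
    (by
      rintro l v S c' rfl
      exact ⟨_, rfl, by simp only [hm, Stmt.stepAux_relabel]⟩) h rfl
  rw [h₂] at h₁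
  exact h₁

/-- A single straight-line statement. -/
def ofStmt (q : Stmt Γ Unit σ) : StackProgram Γ σ where
  Λ := Unit
  entry := ()
  code _ := q

theorem runs_ofStmt {q : Stmt Γ Unit σ} {v v' : σ} {S S' : ∀ k, List (Γ k)}
    (h : stepAux q v S = ⟨none, v', S'⟩) : (ofStmt q).Runs v S v' S' 1 := by
  have := ReachIn.single (fun _ : Unit => q) () v S
  rw [h] at this
  exact this

/-- Sequential composition. -/
def seq (F G : StackProgram Γ σ) : StackProgram Γ σ where
  Λ := F.Λ ⊕ G.Λ
  entry := Sum.inl F.entry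
  code := Sum.elim (fun l => (F.code l).relabel Sum.inl (some (Sum.inr G.entry)))
    (fun l => (G.code l).relabel Sum.inr none)

theorem Runs.seq {F G : StackProgram Γ σ} {v₁ v₂ v₃ : σ} {S₁ S₂ S₃ : ∀ k, List (Γ k)}
    {n₁ n₂ : ℕ} (h₁ : F.Runs v₁ S₁ v₂ S₂ n₁) (h₂ : G.Runs v₂ S₂ v₃ S₃ n₂) :
    (F.seq G).Runs v₁ S₁ v₃ S₃ (n₁ + n₂) :=
  (h₁.relabel (m := (F.seq G).code) Sum.inl (some (Sum.inr G.entry)) fun _ => rfl).trans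
    (h₂.relabel (m := (F.seq G).code) Sum.inr none fun _ => rfl)

/-- Pop the stack `k`, recording the result in the internal state by `rd`, and execute the body
and repeat as long as the internal state satisfies `test`. -/
def loop (k : K) (rd : σ → Option (Γ k) → σ) (test : σ → Bool) (F : StackProgram Γ σ) :
    StackProgram Γ σ where
  Λ := Option F.Λ
  entry := none
  code := fun l => l.elim (.pop k rd (.branch test (.goto fun _ => some F.entry) .halt))
    (fun l => (F.code l).relabel some (some none))

theorem runs_loop_nil {k : K} {rd : σ → Option (Γ k) → σ} {test : σ → Bool}
    (F : StackProgram Γ σ) {v : σ} {S : ∀ k, List (Γ k)} (hS : S k = [])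
    (hend : test (rd v none) = false) : (loop k rd test F).Runs v S (rd v none) S 1 := by
  have h := ReachIn.single (loop k rd test F).code none v S
  have e : stepAux ((loop k rd test F).code none) v S = ⟨none, rd v none, S⟩ := by
    simp only [loop, Option.elim, stepAux, hS, List.head?_nil, hend, cond_false, List.tail_nil]
    exact congrArg _ ((congrArg (Function.update S k) hS.symm).trans (Function.update_eq_self k S))
  rw [e] at h
  exact h

theorem runs_loop_cons {k : K} {rd : σ → Option (Γ k) → σ} {test : σ → Bool}
    {F : StackProgram Γ σ} {v v₁ v₂ : σ} {S S₁ S₂ : ∀ k, List (Γ k)} {b : Γ k} {l : List (Γ k)}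
    {n₁ n₂ : ℕ} (hS : S k = b :: l) (htest : test (rd v (some b)) = true)
    (hbody : F.Runs (rd v (some b)) (Function.update S k l) v₁ S₁ n₁)
    (hrest : (loop k rd test F).Runs v₁ S₁ v₂ S₂ n₂) :
    (loop k rd test F).Runs v S v₂ S₂ (n₁ + 1 + n₂) := by
  have h := ReachIn.single (loop k rd test F).code none v S
  have e : stepAux ((loop k rd test F).code none) v S =
      ⟨some (some F.entry), rd v (some b), Function.update S k l⟩ := by
    simp only [loop, Option.elim, stepAux, hS, List.head?_cons, htest, cond_true, List.tail_cons]
  rw [e] at h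
  have h₁ := hbody.relabel (m := (loop k rd test F).code) some (some none) fun _ => rfl
  exact ((h.trans h₁).trans hrest).mono (by omega)

/-- Moving the stack `k` onto the stack `k'`, translating each symbol by `φ`, reverses it. The
hypotheses say that `rd` overwrites a buffer in the internal state, that `test` tells whether the
buffer is full, and that `g` reads it. -/
theorem runs_move {k k' : K} (hk : k ≠ k') {rd : σ → Option (Γ k) → σ} {test : σ → Bool}
    {g : σ → Γ k'} {φ : Γ k → Γ k'} (v : σ) (S : ∀ k, List (Γ k)) (l : List (Γ k))
    (acc : List (Γ k')) (hS : S k = l) (hS' : S k' = acc)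
    (hrd : ∀ o o', rd (rd v o) o' = rd v o') (htest : ∀ b, test (rd v (some b)) = true)
    (hend : test (rd v none) = false) (hg : ∀ b, g (rd v (some b)) = φ b) :
    (loop k rd test (ofStmt (.push k' g .halt))).Runs v S (rd v none)
      (Function.update (Function.update S k []) k' ((l.map φ).reverse ++ acc))
      (2 * l.length + 1) := by
  induction l generalizing v S acc with
  | nil =>
    have e : Function.update (Function.update S k []) k' ((List.map φ []).reverse ++ acc) = S := by
      subst hS'
      rw [← hS, Function.update_eq_self]
      simp [hS]
    rw [e]
    exact runs_loop_nil _ hS hend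
  | cons b l ih =>
    have h := ih (rd v (some b)) (Function.update (Function.update S k l) k' (φ b :: acc))
      (φ b :: acc) (by rw [Function.update_of_ne hk, Function.update_self])
      (by rw [Function.update_self]) (fun o o' => by simp only [hrd])
      (fun b => by rw [hrd]; exact htest b) (by rw [hrd]; exact hend)
      (fun b => by rw [hrd]; exact hg b)
    have e : ∀ X, Function.update (Function.update (Function.update (Function.update S k l) k'
        (φ b :: acc)) k []) k' X = Function.update (Function.update S k []) k' X := by
      intro X
      rw [Function.update_comm hk, Function.update_idem, Function.update_comm hk,
        Function.update_idem, Function.update_comm hk.symm]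
    rw [hrd, e] at h
    have h₁ : (ofStmt (.push k' g .halt)).Runs (rd v (some b)) (Function.update S k l)
        (rd v (some b)) (Function.update (Function.update S k l) k' (φ b :: acc)) 1 := by
      apply runs_ofStmt
      simp only [stepAux, hg, Function.update_of_ne hk.symm, hS']
    refine (runs_loop_cons hS (htest b) h₁ ?_).mono (n := 1 + 1 + (2 * l.length + 1))
      (by simp only [List.length_cons]; omega)
    simpa using h

/-- The program acting on some of the stacks and a component of the internal state of a larger
machine. -/
def lift {K' : Type} {Γ : K' → Type} {σ' : Type} (i : K → K') (get : σ' → σ)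
    (set : σ → σ' → σ') (F : StackProgram (fun k => Γ (i k)) σ) : StackProgram Γ σ' where
  Λ := F.Λ
  entry := F.entry
  code l := (F.code l).lift i get set

theorem Runs.lift {K' : Type} [DecidableEq K'] {Γ : K' → Type} {σ' : Type} {i : K → K'}
    (hi : Function.Injective i) {get : σ' → σ} {set : σ → σ' → σ'}
    (get_set : ∀ a v, get (set a v) = a) (set_set : ∀ a b v, set a (set b v) = set a v)
    {F : StackProgram (fun k => Γ (i k)) σ} {v v' : σ} {S S' : ∀ k, List (Γ (i k))} {n : ℕ}
    (h : F.Runs v S v' S' n) (w : σ') (T T' : ∀ k, List (Γ k)) (hT : ∀ k, T (i k) = S k)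
    (hT' : ∀ k, T' (i k) = S' k) (hTT' : ∀ k, k ∉ Set.range i → T' k = T k) :
    (F.lift i get set).Runs (set v w) T (set v' w) T' n := by
  obtain ⟨⟨l, w', U⟩, h₁, h₂⟩ := ReachIn.simulate (m' := (F.lift i get set).code)
    (Stmt.LiftRel i set w T)
    (by
      rintro l v S ⟨l', w', U⟩ ⟨hl, hv, hs, hs'⟩
      dsimp only at hl hv hs hs'
      subst hl hv
      exact ⟨_, rfl, Stmt.stepAux_lift hi get_set set_set w T _ v S U hs hs'⟩) h
    (c' := ⟨some F.entry, set v w, T⟩) ⟨rfl, rfl, hT, fun _ _ => rfl⟩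
  obtain ⟨hl, hv, hs, hs'⟩ := h₂
  dsimp only at hl hv hs hs'
  subst hl hv
  have : U = T' := by
    funext k
    by_cases hk : k ∈ Set.range i
    · obtain ⟨k, rfl⟩ := hk
      rw [hs, hT']
    · rw [hs' k hk, hTT' k hk]
  subst this
  exact h₁

end StackProgram

end Turing

/-! ### Composition of polynomial-time computations -/

namespace Turing

open TM2

theorem _root_.Polynomial.eval_nat_mono (p : Polynomial ℕ) : Monotone fun n => p.eval n := by
  intro a b h
  dsimp only
  rw [Polynomial.eval_eq_sum, Polynomial.eval_eq_sum]
  exact Finset.sum_le_sum fun i _ => Nat.mul_le_mul_left _ (Nat.pow_le_pow_left h i)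

/-- The number of `push` instructions in a statement. -/
def TM2.Stmt.pushes {K : Type} {Γ : K → Type} {Λ σ : Type} : Stmt Γ Λ σ → ℕ
  | .push _ _ q => pushes q + 1
  | .peek _ _ q => pushes q
  | .pop _ _ q => pushes q
  | .load _ q => pushes q
  | .branch _ q₁ q₂ => pushes q₁ + pushes q₂
  | .goto _ => 0
  | .halt => 0

section

variable {K : Type} [DecidableEq K] {Γ : K → Type} {Λ σ : Type}

/-- One step lengthens each stack by at most the number of `push` instructions of its statement. -/
theorem length_stepAux_le (q : Stmt Γ Λ σ) (v : σ) (S : ∀ k, List (Γ k)) (k : K) :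
    ((stepAux q v S).stk k).length ≤ (S k).length + q.pushes := by
  induction q generalizing v S with
  | push k' g q ih =>
    refine (ih _ _).trans ?_
    by_cases h : k = k'
    · subst h; simp [TM2.Stmt.pushes]; omega
    · simp [TM2.Stmt.pushes, h]
  | peek k' g q ih => exact ih _ _
  | pop k' g q ih =>
    refine (ih _ _).trans ?_
    by_cases h : k = k'
    · subst h; simp [TM2.Stmt.pushes]
    · simp [TM2.Stmt.pushes, h]
  | load g q ih => exact ih _ _
  | branch g q₁ q₂ ih₁ ih₂ =>
    simp only [stepAux, TM2.Stmt.pushes]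
    cases g v
    · exact (ih₂ _ _).trans (by omega)
    · exact (ih₁ _ _).trans (by omega)
  | goto g => simp
  | halt => simp

theorem ReachIn.length_stk_le [Fintype Λ] {m : Λ → Stmt Γ Λ σ} {c c' : Cfg Γ Λ σ} {n : ℕ}
    (h : ReachIn m c c' n) (k : K) :
    (c'.stk k).length ≤ (c.stk k).length + (∑ l, (m l).pushes) * n := by
  obtain ⟨j, hj, e⟩ := h
  refine le_trans ?_ (Nat.add_le_add_left (Nat.mul_le_mul_left _ hj) _)
  clear hj
  induction j generalizing c with
  | zero =>
    obtain rfl : c = c' := Option.some.inj e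
    simp
  | succ j ih =>
    obtain ⟨l, v, S⟩ := c
    rw [Function.iterate_succ_apply] at e
    cases l with
    | none => exact absurd ((iterate_step_none m j).symm.trans e) (by simp)
    | some l =>
      refine (ih e).trans ?_
      have h₁ := length_stepAux_le (m l) v S k
      have h₂ : (m l).pushes ≤ ∑ l, (m l).pushes :=
        Finset.single_le_sum (f := fun l => (m l).pushes) (fun _ _ => Nat.zero_le _)
          (Finset.mem_univ l)
      rw [Nat.mul_succ]
      dsimp only
      omega

end

/-- The program of a bundled machine. -/
def FinTM2.toProgram (M : FinTM2) : StackProgram M.Γ M.σ where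
  Λ := M.Λ
  fin := M.ΛFin
  entry := M.main
  code := M.m

theorem initList_eq (M : FinTM2) (s : List (M.Γ M.k₀)) :
    initList M s = ⟨some M.main, M.initialState, Function.update (fun _ => []) M.k₀ s⟩ := by
  unfold initList
  congr 1
  funext k
  by_cases h : k = M.k₀
  · subst h; simp
  · simp [h]

theorem haltList_eq (M : FinTM2) (s : List (M.Γ M.k₁)) :
    haltList M s = ⟨none, M.initialState, Function.update (fun _ => []) M.k₁ s⟩ := by
  unfold haltList
  congr 1
  funext k
  by_cases h : k = M.k₁
  · subst h; simp
  · simp [h]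

theorem FinTM2.runs_toProgram (M : FinTM2) {s : List (M.Γ M.k₀)} {s' : List (M.Γ M.k₁)} {n : ℕ}
    (h : TM2OutputsInTime M s (some s') n) :
    M.toProgram.Runs M.initialState (Function.update (fun _ => []) M.k₀ s) M.initialState
      (Function.update (fun _ => []) M.k₁ s') n := by
  obtain ⟨⟨k, e⟩, hk⟩ := h
  refine ⟨k, hk, ?_⟩
  rw [initList_eq, Option.map_some, haltList_eq] at e
  exact e

theorem FinTM2.nonempty_outputsInTime (M : FinTM2) {s : List (M.Γ M.k₀)} {s' : List (M.Γ M.k₁)}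
    {n : ℕ} (h : M.toProgram.Runs M.initialState (Function.update (fun _ => []) M.k₀ s)
      M.initialState (Function.update (fun _ => []) M.k₁ s') n) :
    Nonempty (TM2OutputsInTime M s (some s') n) := by
  obtain ⟨k, hk, e⟩ := h
  refine ⟨⟨⟨k, ?_⟩, hk⟩⟩
  rw [initList_eq, Option.map_some, haltList_eq]
  exact e

namespace Comp

variable (M₁ M₂ : FinTM2) (B : Type)

/-- The stack alphabets of the composite machine: those of both machines, and `B` on an auxiliary
stack. -/
abbrev Alph : M₁.K ⊕ M₂.K ⊕ Unit → Type :=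
  Sum.elim M₁.Γ (Sum.elim M₂.Γ fun _ => B)

variable {M₁ M₂ B}

/-- The stacks of the composite machine. -/
def joinStacks (S₁ : ∀ k, List (M₁.Γ k)) (S₂ : ∀ k, List (M₂.Γ k)) (l : List B) :
    ∀ k, List (Alph M₁ M₂ B k)
  | .inl k => S₁ k
  | .inr (.inl k) => S₂ k
  | .inr (.inr _) => l

theorem update_joinStacks_inl (S₁ : ∀ k, List (M₁.Γ k)) (S₂ : ∀ k, List (M₂.Γ k)) (l : List B)
    (k : M₁.K) (x : List (M₁.Γ k)) :
    Function.update (joinStacks S₁ S₂ l) (.inl k) x =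
      joinStacks (Function.update S₁ k x) S₂ l := by
  funext k'
  by_cases h : k' = .inl k
  · subst h
    exact (Function.update_self _ _ _).trans (Function.update_self k x S₁).symm
  · refine (Function.update_of_ne h _ _).trans ?_
    rcases k' with k' | k' | k'
    · exact (Function.update_of_ne (fun h' => h (congrArg _ h')) x S₁).symm
    · rfl
    · rfl

theorem update_joinStacks_inr_inl (S₁ : ∀ k, List (M₁.Γ k)) (S₂ : ∀ k, List (M₂.Γ k))
    (l : List B) (k : M₂.K) (x : List (M₂.Γ k)) :
    Function.update (joinStacks S₁ S₂ l) (.inr (.inl k)) x =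
      joinStacks S₁ (Function.update S₂ k x) l := by
  funext k'
  by_cases h : k' = .inr (.inl k)
  · subst h
    exact (Function.update_self _ _ _).trans (Function.update_self k x S₂).symm
  · refine (Function.update_of_ne h _ _).trans ?_
    rcases k' with k' | k' | k'
    · rfl
    · have h' : k' ≠ k := fun e => h (by rw [e])
      exact (Function.update_of_ne h' x S₂).symm
    · rfl

theorem update_joinStacks_inr_inr (S₁ : ∀ k, List (M₁.Γ k)) (S₂ : ∀ k, List (M₂.Γ k))
    (l x : List B) :
    Function.update (joinStacks S₁ S₂ l) (.inr (.inr ())) x = joinStacks S₁ S₂ x := by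
  funext k'
  by_cases h : k' = .inr (.inr ())
  · subst h
    exact Function.update_self _ _ _
  · refine (Function.update_of_ne h _ _).trans ?_
    rcases k' with k' | k' | k'
    · rfl
    · rfl
    · exact absurd rfl h

variable [Inhabited B]

/-- Run the first machine, move its output to the input stack of the second one by way of the
auxiliary stack, and run the second machine. -/
def program (e₁ : M₁.Γ M₁.k₁ ≃ B) (e₂ : M₂.Γ M₂.k₀ ≃ B) :
    StackProgram (Alph M₁ M₂ B) (M₁.σ × M₂.σ × Option B) :=
  (M₁.toProgram.lift (Γ := Alph M₁ M₂ B) Sum.inl (fun v => v.1) (fun a v => (a, v.2))).seq <|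
  (StackProgram.loop (Γ := Alph M₁ M₂ B) (.inl M₁.k₁) (fun v o => (v.1, v.2.1, o.map e₁))
    (fun v => v.2.2.isSome) (.ofStmt (.push (.inr (.inr ())) (fun v => v.2.2.getD (default : B))
      .halt))).seq <|
  (StackProgram.loop (Γ := Alph M₁ M₂ B) (.inr (.inr ())) (fun v o => (v.1, v.2.1, o))
    (fun v => v.2.2.isSome) (.ofStmt (.push (.inr (.inl M₂.k₀))
      (fun v => e₂.symm (v.2.2.getD (default : B))) .halt))).seq <|
  M₂.toProgram.lift (Γ := Alph M₁ M₂ B) (fun k => Sum.inr (Sum.inl k)) (fun v => v.2.1)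
    (fun a v => (v.1, a, v.2.2))

theorem runs_program (e₁ : M₁.Γ M₁.k₁ ≃ B) (e₂ : M₂.Γ M₂.k₀ ≃ B) {s : List (M₁.Γ M₁.k₀)}
    {u : List B} {s' : List (M₂.Γ M₂.k₁)} {n₁ n₂ : ℕ}
    (h₁ : TM2OutputsInTime M₁ s (some (u.map e₁.symm)) n₁)
    (h₂ : TM2OutputsInTime M₂ (u.map e₂.symm) (some s') n₂) :
    (program e₁ e₂).Runs (M₁.initialState, M₂.initialState, none)
      (Function.update (fun _ => []) (.inl M₁.k₀) s) (M₁.initialState, M₂.initialState, none)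
      (Function.update (fun _ => []) (.inr (.inl M₂.k₁)) s')
      (n₁ + ((2 * u.length + 1) + ((2 * u.length + 1) + n₂))) := by
  have e₀ : (fun _ => [] : ∀ k, List (Alph M₁ M₂ B k)) =
      joinStacks (fun _ => []) (fun _ => []) [] := by
    funext k; rcases k with k | k | k <;> rfl
  rw [e₀, update_joinStacks_inl, update_joinStacks_inr_inl]
  refine StackProgram.Runs.seq (v₂ := (M₁.initialState, M₂.initialState, none))
    (S₂ := joinStacks (Function.update (fun _ => []) M₁.k₁ (u.map e₁.symm)) (fun _ => []) []) ?_ <|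
    StackProgram.Runs.seq (v₂ := (M₁.initialState, M₂.initialState, none))
      (S₂ := joinStacks (fun _ => []) (fun _ => []) u.reverse) ?_ <|
    StackProgram.Runs.seq (v₂ := (M₁.initialState, M₂.initialState, none))
      (S₂ := joinStacks (fun _ => []) (Function.update (fun _ => []) M₂.k₀ (u.map e₂.symm)) [])
      ?_ ?_
  · refine StackProgram.Runs.lift (Γ := Alph M₁ M₂ B) Sum.inl_injective
      (get := fun v : M₁.σ × M₂.σ × Option B => v.1)
      (set := fun a v => (a, v.2)) (fun _ _ => rfl)
      (fun _ _ _ => rfl) (M₁.runs_toProgram h₁) (M₁.initialState, M₂.initialState, none)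
      (joinStacks (Function.update (fun _ => []) M₁.k₀ s) (fun _ => []) [])
      (joinStacks (Function.update (fun _ => []) M₁.k₁ (u.map e₁.symm)) (fun _ => []) [])
      (fun _ => rfl) (fun _ => rfl) ?_
    rintro (k | k | k) hk
    · exact absurd ⟨k, rfl⟩ hk
    · rfl
    · rfl
  · have h := StackProgram.runs_move (Γ := Alph M₁ M₂ B) (k := .inl M₁.k₁) (k' := .inr (.inr ()))
      (by simp) (rd := fun v o => (v.1, v.2.1, o.map e₁))
      (test := fun v => v.2.2.isSome) (g := fun v => v.2.2.getD (default : B)) (φ := e₁)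
      (M₁.initialState, M₂.initialState, none)
      (joinStacks (Function.update (fun _ => []) M₁.k₁ (u.map e₁.symm)) (fun _ => []) [])
      (u.map e₁.symm) [] (by simp [joinStacks]) rfl (fun _ _ => rfl) (fun _ => rfl) rfl
      (fun _ => rfl)
    refine h.congr rfl ?_ (by simp)
    · refine ((congrArg (fun T => Function.update T _ _)
        (update_joinStacks_inl _ _ _ _ _)).trans ((update_joinStacks_inr_inr _ _ _ _).trans ?_))
      exact congrArg₂ (fun S l => joinStacks S (fun _ => []) l)
        ((Function.update_idem _ _ _).trans (Function.update_eq_self M₁.k₁ fun _ => []))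
        (by simp : ((u.map e₁.symm).map e₁).reverse ++ [] = u.reverse)
  · have h := StackProgram.runs_move (Γ := Alph M₁ M₂ B) (k := .inr (.inr ()))
      (k' := .inr (.inl M₂.k₀)) (by simp) (rd := fun v o => (v.1, v.2.1, o))
      (test := fun v => v.2.2.isSome) (g := fun v => e₂.symm (v.2.2.getD (default : B)))
      (φ := e₂.symm)
      (M₁.initialState, M₂.initialState, none)
      (joinStacks (fun _ => []) (fun _ => []) u.reverse)
      u.reverse [] rfl rfl (fun _ _ => rfl) (fun _ => rfl) rfl
      (fun _ => rfl)
    refine h.congr rfl ?_ (by simp)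
    · refine ((congrArg (fun T => Function.update T _ _)
        (update_joinStacks_inr_inr _ _ _ _)).trans
        ((update_joinStacks_inr_inl _ _ _ _ _).trans ?_))
      exact congrArg (fun l => joinStacks _ (Function.update _ _ l) _)
        (by simp : (u.reverse.map e₂.symm).reverse ++ [] = u.map e₂.symm)
  · refine StackProgram.Runs.lift (Γ := Alph M₁ M₂ B) (i := fun k => Sum.inr (Sum.inl k))
      (Sum.inr_injective.comp Sum.inl_injective)
      (get := fun v : M₁.σ × M₂.σ × Option B => v.2.1)
      (set := fun a v => (v.1, a, v.2.2)) (fun _ _ => rfl)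
      (fun _ _ _ => rfl) (M₂.runs_toProgram h₂) (M₁.initialState, M₂.initialState, none)
      (joinStacks (fun _ => []) (Function.update (fun _ => []) M₂.k₀ (u.map e₂.symm)) [])
      (joinStacks (fun _ => []) (Function.update (fun _ => []) M₂.k₁ s') [])
      (fun _ => rfl) (fun _ => rfl) ?_
    rintro (k | k | k) hk
    · rfl
    · exact absurd ⟨k, rfl⟩ hk
    · rfl

/-- The composite machine. -/
def machine [Fintype B] (e₁ : M₁.Γ M₁.k₁ ≃ B) (e₂ : M₂.Γ M₂.k₀ ≃ B) : FinTM2 :=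
  letI := M₁.kFin
  letI := M₂.kFin
  letI := M₁.σFin
  letI := M₂.σFin
  { K := M₁.K ⊕ M₂.K ⊕ Unit
    k₀ := .inl M₁.k₀
    k₁ := .inr (.inl M₂.k₁)
    Γ := Alph M₁ M₂ B
    Λ := (program e₁ e₂).Λ
    main := (program e₁ e₂).entry
    σ := M₁.σ × M₂.σ × Option B
    initialState := (M₁.initialState, M₂.initialState, none)
    Γk₀Fin := M₁.Γk₀Fin
    m := (program e₁ e₂).code }

end Comp

/-- If `f a` is computable from `ea a` in polynomial time, and `g a` from `f a`, then `g a` is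
computable from `ea a` in polynomial time. The time of the second computation is polynomial in the
length of `f a`, which is at most linear in the time of the first one. -/
theorem TM2ComputableInPolyTime.nonempty_comp {α Γ₀ Γ₁ Γ₂ : Type} [Inhabited Γ₁] [Fintype Γ₁]
    {ea : α → List Γ₀} {f : α → List Γ₁} {g : α → List Γ₂}
    (h₁ : TM2ComputableInPolyTime ea (id : List Γ₁ → List Γ₁) f)
    (h₂ : TM2ComputableInPolyTime f (id : List Γ₂ → List Γ₂) g) :
    Nonempty (TM2ComputableInPolyTime ea (id : List Γ₂ → List Γ₂) g) := by
  let c := ∑ l, (h₁.tm.toProgram.code l).pushes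
  let p : Polynomial ℕ := Polynomial.X + Polynomial.C c * h₁.time
  have hlen : ∀ a, (f a).length ≤ p.eval (ea a).length := by
    intro a
    have h := (h₁.tm.runs_toProgram (h₁.outputsFun a)).length_stk_le h₁.tm.k₁
    simp only [Function.update_self, List.length_map, id] at h
    refine h.trans ?_
    simp only [p, Polynomial.eval_add, Polynomial.eval_X, Polynomial.eval_mul, Polynomial.eval_C]
    refine Nat.add_le_add_right ?_ _
    by_cases hk : h₁.tm.k₁ = h₁.tm.k₀
    · generalize h₁.tm.k₁ = k at hk
      subst hk
      simp
    · simp [hk]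
  have hout : ∀ a, Nonempty (TM2OutputsInTime
      (Comp.machine h₁.outputAlphabet h₂.inputAlphabet)
      ((ea a).map h₁.inputAlphabet.symm) (some ((g a).map h₂.outputAlphabet.symm))
      ((h₁.time + (2 * p + 1) + (2 * p + 1) + h₂.time.comp p).eval (ea a).length)) := by
    intro a
    refine FinTM2.nonempty_outputsInTime _ ?_
    refine (Comp.runs_program h₁.outputAlphabet h₂.inputAlphabet (h₁.outputsFun a)
      (h₂.outputsFun a)).mono ?_
    have h₃ := Polynomial.eval_nat_mono h₂.time (hlen a)
    have h₄ := hlen a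
    simp only [Polynomial.eval_add, Polynomial.eval_mul, Polynomial.eval_one,
      Polynomial.eval_comp, Polynomial.eval_ofNat]
    dsimp only at h₃
    simp only [id]
    omega
  exact ⟨{
    tm := Comp.machine h₁.outputAlphabet h₂.inputAlphabet
    inputAlphabet := h₁.inputAlphabet
    outputAlphabet := h₂.outputAlphabet
    time := _
    outputsFun := fun a => (hout a).some }⟩

end Turing

/-! ### Register programs -/

namespace Turing

open TM2

/-- A program on the stacks `0, …, N` over the alphabet `Bool`, whose internal state is a buffer
for one popped symbol. -/
abbrev RegProgram (N : ℕ) := StackProgram (fun _ : Fin (N + 1) => Bool) (Option Bool)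

namespace RegProgram

variable {N : ℕ}

/-- The program takes the stacks from `s` to `s'` in at most `T` steps, from empty buffer to empty
buffer. Stacks are numbered by all natural numbers; those beyond `N` do not matter. -/
def Exec (F : RegProgram N) (s s' : ℕ → List Bool) (T : ℕ) : Prop :=
  F.Runs none (fun i => s i) none (fun i => s' i) T

theorem Exec.congr {F : RegProgram N} {s s' s'' : ℕ → List Bool} {T T' : ℕ} (h : F.Exec s s' T)
    (hs : s' = s'') (hT : T ≤ T') : F.Exec s s'' T' := by
  subst hs
  exact h.mono hT

theorem Exec.seq {F G : RegProgram N} {s₁ s₂ s₃ : ℕ → List Bool} {T₁ T₂ : ℕ}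
    (h₁ : F.Exec s₁ s₂ T₁) (h₂ : G.Exec s₂ s₃ T₂) :
    Exec (StackProgram.seq F G) s₁ s₃ (T₁ + T₂) :=
  StackProgram.Runs.seq h₁ h₂

/-- The stack with number `i`, provided that `i ≤ N`. -/
abbrev reg (i : ℕ) : Fin (N + 1) := Fin.ofNat (N + 1) i

theorem val_reg {i : ℕ} (hi : i ≤ N) : ((reg i : Fin (N + 1)) : ℕ) = i :=
  Nat.mod_eq_of_lt (by omega)

theorem update_reg (s : ℕ → List Bool) {i : ℕ} (hi : i ≤ N) (l : List Bool) :
    Function.update (fun k : Fin (N + 1) => s k) (reg i) l =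
      fun k : Fin (N + 1) => Function.update s i l k := by
  funext k
  by_cases h : k = reg i
  · subst h
    rw [Function.update_self, val_reg hi, Function.update_self]
  · have h' : (k : ℕ) ≠ i := fun e => h (Fin.ext (by rw [val_reg hi, e]))
    rw [Function.update_of_ne h, Function.update_of_ne h']

/-- Push `b` on stack `i`. -/
def push (i : ℕ) (b : Bool) : RegProgram N :=
  .ofStmt (.push (reg i) (fun _ => b) .halt)

theorem exec_push {i : ℕ} (hi : i ≤ N) (b : Bool) (s : ℕ → List Bool) :
    (push i b : RegProgram N).Exec s (Function.update s i (b :: s i)) 1 := by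
  apply StackProgram.runs_ofStmt
  simp only [stepAux, val_reg hi, update_reg s hi]

/-- Pop stack `i`. -/
def pop (i : ℕ) : RegProgram N :=
  .ofStmt (.pop (reg i) (fun v _ => v) .halt)

theorem exec_pop {i : ℕ} (hi : i ≤ N) (s : ℕ → List Bool) :
    (pop i : RegProgram N).Exec s (Function.update s i (s i).tail) 1 := by
  apply StackProgram.runs_ofStmt
  simp only [stepAux, val_reg hi, update_reg s hi]

/-- Move the top of stack `i`, if there is one, to stack `j`. -/
def shift (i j : ℕ) : RegProgram N :=
  .ofStmt (.pop (reg i) (fun _ o => o) (.branch Option.isSome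
    (.push (reg j) (fun v => v.getD false) (.load (fun _ => none) .halt)) .halt))

theorem exec_shift_nil {i : ℕ} (hi : i ≤ N) (j : ℕ) (s : ℕ → List Bool) (hs : s i = []) :
    (shift i j : RegProgram N).Exec s s 1 := by
  apply StackProgram.runs_ofStmt
  simp only [stepAux, val_reg hi, hs, List.head?_nil, Option.isSome_none, cond_false,
    List.tail_nil, update_reg s hi]
  rw [← hs, Function.update_eq_self]

theorem exec_shift_cons {i j : ℕ} (hi : i ≤ N) (hj : j ≤ N) (hij : i ≠ j) (s : ℕ → List Bool)
    {b : Bool} {l : List Bool} (hs : s i = b :: l) :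
    (shift i j : RegProgram N).Exec s
      (Function.update (Function.update s i l) j (b :: s j)) 1 := by
  apply StackProgram.runs_ofStmt
  simp only [stepAux, val_reg hi, hs, List.head?_cons, Option.isSome_some, cond_true,
    List.tail_cons, update_reg _ hi, update_reg _ hj, val_reg hj,
    Function.update_of_ne hij.symm, Option.getD_some]

/-- Push `true` on stack `j` if the top of stack `i` is `true`. -/
def peekTrue (i j : ℕ) : RegProgram N :=
  .ofStmt (.peek (reg i) (fun _ o => o) (.branch (fun v => v.getD false)
    (.push (reg j) (fun _ => true) (.load (fun _ => none) .halt)) (.load (fun _ => none) .halt)))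

theorem exec_peekTrue {i j : ℕ} (hi : i ≤ N) (hj : j ≤ N) (s : ℕ → List Bool) :
    (peekTrue i j : RegProgram N).Exec s
      (Function.update s j (List.replicate ((s i).head?.getD false).toNat true ++ s j)) 1 := by
  apply StackProgram.runs_ofStmt
  simp only [stepAux, val_reg hi]
  cases (s i).head?.getD false
  · simp
  · simp only [cond_true, val_reg hj, update_reg _ hj, Bool.toNat_true,
      List.replicate_one, List.singleton_append]

/-- Push on stack `j` the bit telling whether stack `i` is nonempty. -/
def pushNonempty (i j : ℕ) : RegProgram N :=
  .ofStmt (.peek (reg i) (fun _ o => o) (.push (reg j) Option.isSome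
    (.load (fun _ => none) .halt)))

theorem exec_pushNonempty {i j : ℕ} (hi : i ≤ N) (hj : j ≤ N) (s : ℕ → List Bool) :
    (pushNonempty i j : RegProgram N).Exec s
      (Function.update s j ((s i).head?.isSome :: s j)) 1 := by
  apply StackProgram.runs_ofStmt
  simp only [stepAux, val_reg hi, val_reg hj, update_reg _ hj]

/-- Move stack `i` to stack `j`, reversing it. -/
def move (i j : ℕ) : RegProgram N :=
  .loop (reg i) (fun _ o => o) Option.isSome
    (.ofStmt (.push (reg j) (fun v => v.getD false) .halt))

theorem exec_move {i j : ℕ} (hi : i ≤ N) (hj : j ≤ N) (hij : i ≠ j) (s : ℕ → List Bool) :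
    (move i j : RegProgram N).Exec s
      (Function.update (Function.update s i []) j ((s i).reverse ++ s j))
      (2 * (s i).length + 1) := by
  have hij' : (reg i : Fin (N + 1)) ≠ reg j := fun h => hij (by
    rw [← val_reg hi, ← val_reg hj, h])
  have h := StackProgram.runs_move hij' (rd := fun _ o => o) (test := Option.isSome)
    (g := fun v => v.getD false) (φ := fun b => b) none (fun k => s k) (s i) (s j)
    (by rw [val_reg hi]) (by rw [val_reg hj]) (fun _ _ => rfl) (fun _ => rfl) rfl (fun _ => rfl)
  refine h.congr rfl ?_ le_rfl
  rw [update_reg _ hi, update_reg _ hj, List.map_id']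

/-- Move stack `i` to stack `j`, and push as many symbols on stack `k`. -/
def moveCount (i j k : ℕ) : RegProgram N :=
  .loop (reg i) (fun _ o => o) Option.isSome
    (.ofStmt (.push (reg j) (fun v => v.getD false) (.push (reg k) (fun _ => true) .halt)))

theorem exec_moveCount {i j k : ℕ} (hi : i ≤ N) (hj : j ≤ N) (hk : k ≤ N) (hij : i ≠ j)
    (hik : i ≠ k) (hjk : j ≠ k) (s : ℕ → List Bool) :
    (moveCount i j k : RegProgram N).Exec s
      (Function.update (Function.update (Function.update s i []) j ((s i).reverse ++ s j)) k
        (List.replicate (s i).length true ++ s k))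
      (2 * (s i).length + 1) := by
  suffices H : ∀ (l : List Bool) (v : Option Bool) (s : ℕ → List Bool), s i = l →
      (moveCount i j k : RegProgram N).Runs v (fun x => s x) none
      (fun x => Function.update (Function.update (Function.update s i []) j
        ((s i).reverse ++ s j)) k (List.replicate (s i).length true ++ s k) x)
      (2 * l.length + 1) from H _ none s rfl
  intro l
  induction l with
  | nil =>
    intro v s hs
    refine (StackProgram.runs_loop_nil _ (v := v) (S := fun x : Fin (N + 1) => s x)
      (by rw [val_reg hi, hs]) rfl).congr rfl ?_ (by simp)
    funext x
    simp only [hs, Function.update_apply, List.reverse_nil, List.nil_append, List.length_nil,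
      List.replicate_zero]
    split_ifs <;> simp_all
  | cons b l ih =>
    intro v s hs
    let s₁ := Function.update (Function.update (Function.update s i l) j (b :: s j)) k
      (true :: s k)
    have h := ih (some b) s₁ (by simp [s₁, hij, hik])
    refine (StackProgram.runs_loop_cons (n₁ := 1) (S := fun x : Fin (N + 1) => s x)
      (v₁ := some b) (b := b) (l := l) (by rw [val_reg hi, hs]) rfl ?_ h).congr rfl ?_
      (by simp only [List.length_cons]; omega)
    · apply StackProgram.runs_ofStmt
      simp only [stepAux, update_reg _ hi, val_reg hj, update_reg _ hj, val_reg hk,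
        update_reg _ hk, Function.update_of_ne hij.symm, Function.update_of_ne hjk.symm,
        Function.update_of_ne hik.symm, Option.getD_some, s₁]
    · funext x
      simp only [s₁, hs, Function.update_apply]
      split_ifs <;> simp_all [List.replicate_succ']

/-- Empty stack `i`. -/
def clear (i : ℕ) : RegProgram N :=
  .loop (reg i) (fun _ o => o) Option.isSome (.ofStmt .halt)

theorem exec_clear {i : ℕ} (hi : i ≤ N) (s : ℕ → List Bool) :
    (clear i : RegProgram N).Exec s (Function.update s i []) (2 * (s i).length + 1) := by
  suffices H : ∀ (l : List Bool) (v : Option Bool) (s : ℕ → List Bool), s i = l →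
      (clear i : RegProgram N).Runs v (fun x => s x) none
      (fun x => Function.update s i [] x) (2 * l.length + 1) from H _ none s rfl
  intro l
  induction l with
  | nil =>
    intro v s hs
    refine (StackProgram.runs_loop_nil _ (v := v) (S := fun x : Fin (N + 1) => s x)
      (by rw [val_reg hi, hs]) rfl).congr rfl ?_ (by simp)
    rw [← hs, Function.update_eq_self]
  | cons b l ih =>
    intro v s hs
    have h := ih (some b) (Function.update s i l) (by simp)
    rw [Function.update_idem] at h
    refine (StackProgram.runs_loop_cons (n₁ := 1) (S := fun x : Fin (N + 1) => s x)
      (v₁ := some b) (b := b) (l := l) (by rw [val_reg hi, hs]) rfl ?_ h).mono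
      (by simp only [List.length_cons]; omega)
    apply StackProgram.runs_ofStmt
    simp only [stepAux, update_reg _ hi]

/-- As long as stack `i` is nonempty, pop it and run `F`. -/
def forLoop (i : ℕ) (F : RegProgram N) : RegProgram N :=
  .loop (reg i) (fun _ o => o) Option.isSome (.seq (.ofStmt (.load (fun _ => none) .halt)) F)

/-- The rule for a loop controlled by a number in unary: `J x` are the stacks at the head of the
loop when `x` rounds are left. -/
theorem exec_forLoop {i : ℕ} (hi : i ≤ N) {F : RegProgram N} (J : ℕ → ℕ → List Bool) (m T : ℕ)
    (hJ : ∀ x, J x i = List.replicate x true)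
    (hbody : ∀ x < m, F.Exec (Function.update (J (x + 1)) i (List.replicate x true)) (J x) T) :
    (forLoop i F).Exec (J m) (J 0) (m * (T + 2) + 1) := by
  induction m with
  | zero =>
    exact (StackProgram.runs_loop_nil _ (v := none) (S := fun x : Fin (N + 1) => J 0 x)
      (by rw [val_reg hi, hJ]; rfl) rfl).mono (by simp)
  | succ m ih =>
    have h := ih fun x hx => hbody x (by omega)
    refine (StackProgram.runs_loop_cons (n₁ := 1 + T) (S := fun x : Fin (N + 1) => J (m + 1) x)
      (v₁ := none) (b := true) (l := List.replicate m true)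
      (by rw [val_reg hi, hJ]; rfl) rfl ?_ h).mono (by ring_nf; omega)
    refine StackProgram.Runs.seq (S₂ := fun k : Fin (N + 1) =>
      Function.update (J (m + 1)) i (List.replicate m true) k) ?_ (hbody m (by omega))
    apply StackProgram.runs_ofStmt
    simp only [stepAux, update_reg _ hi]

/-- Add the unary number on stack `i` to stack `j`, with stack `k` as scratch. -/
def copy (i j k : ℕ) : RegProgram N :=
  .seq (forLoop i (.seq (push j true) (push k true))) (move k i)

theorem exec_copy {i j k : ℕ} (hi : i ≤ N) (hj : j ≤ N) (hk : k ≤ N) (hij : i ≠ j) (hik : i ≠ k)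
    (hjk : j ≠ k) {s : ℕ → List Bool} {m : ℕ} (hsi : s i = List.replicate m true)
    (hsj : s j = []) (hsk : s k = []) :
    (copy i j k : RegProgram N).Exec s (Function.update s j (List.replicate m true))
      (6 * m + 2) := by
  let J : ℕ → ℕ → List Bool := fun x => Function.update (Function.update (Function.update s i
    (List.replicate x true)) j (List.replicate (m - x) true)) k (List.replicate (m - x) true)
  have h₁ : (forLoop i (.seq (push j true) (push k true)) : RegProgram N).Exec (J m) (J 0)
      (m * (2 + 2) + 1) := by
    refine exec_forLoop hi J m 2 (fun x => by simp [J, hij, hik]) fun x hx => ?_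
    refine ((exec_push hj true _).seq (exec_push hk true _)).congr ?_ le_rfl
    have e : m - x = m - (x + 1) + 1 := by omega
    funext y
    simp only [J, Function.update_apply, e, List.replicate_succ]
    split_ifs <;> simp_all
  have h₂ := exec_move hk hi hik.symm (J 0)
  have e : J m = s := by
    funext y
    simp only [J, Function.update_apply]
    split_ifs <;> simp_all
  rw [e] at h₁
  refine (h₁.seq h₂).congr ?_ ?_
  · funext y
    simp only [J, Function.update_apply]
    split_ifs <;> simp_all
  · simp [J]; omega

end RegProgram

end Turing

/-! ### Arithmetic with bounded sums, evaluated in unary -/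

namespace Turing

/-- The bit of `l` at position `k`, as a number; positions beyond the end hold `0`. -/
def bitAt (l : List Bool) (k : ℕ) : ℕ := (l[k]?.getD false).toNat

/-- `Arith inp vs f` says that `f` is given by an expression in the variables `vs`, the length and
the bits of `inp`, built with addition, truncated subtraction and bounded sums. The domain `α` is
the type of all values of the variables, so that the summation variable is the last projection of
`α × ℕ`. -/
inductive Arith : {α : Type} → (α → List Bool) → List (α → ℕ) → (α → ℕ) → Prop
  | head {α : Type} {inp : α → List Bool} (g : α → ℕ) (vs : List (α → ℕ)) : Arith inp (g :: vs) g
  | tail {α : Type} {inp : α → List Bool} (g : α → ℕ) {vs : List (α → ℕ)} {f : α → ℕ} :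
      Arith inp vs f → Arith inp (g :: vs) f
  | one {α : Type} {inp : α → List Bool} {vs : List (α → ℕ)} : Arith inp vs fun _ => 1
  | length {α : Type} {inp : α → List Bool} {vs : List (α → ℕ)} :
      Arith inp vs fun a => (inp a).length
  | bit {α : Type} {inp : α → List Bool} {vs : List (α → ℕ)} {f : α → ℕ} :
      Arith inp vs f → Arith inp vs fun a => bitAt (inp a) (f a)
  | add {α : Type} {inp : α → List Bool} {vs : List (α → ℕ)} {f g : α → ℕ} :
      Arith inp vs f → Arith inp vs g → Arith inp vs fun a => f a + g a
  | sub {α : Type} {inp : α → List Bool} {vs : List (α → ℕ)} {f g : α → ℕ} :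
      Arith inp vs f → Arith inp vs g → Arith inp vs fun a => f a - g a
  | sum {α : Type} {inp : α → List Bool} {vs : List (α → ℕ)} {b : α → ℕ} {f : α → ℕ → ℕ} :
      Arith inp vs b →
      Arith (fun p : α × ℕ => inp p.1) (Prod.snd :: vs.map fun g p => g p.1) (fun p => f p.1 p.2) →
      Arith inp vs fun a => ∑ x ∈ Finset.range (b a), f a x

namespace Arith

/-- The size of the data from which an expression is evaluated. -/
def size {α : Type} (inp : α → List Bool) (vs : List (α → ℕ)) (a : α) : ℕ :=
  (inp a).length + (vs.map fun g => g a).sum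

theorem size_cons {α : Type} (inp : α → List Bool) (g : α → ℕ) (vs : List (α → ℕ)) (a : α) :
    size inp (g :: vs) a = size inp vs a + g a := by
  simp [size]; omega

theorem size_prod {α : Type} (inp : α → List Bool) (vs : List (α → ℕ)) (p : α × ℕ) :
    size (fun p : α × ℕ => inp p.1) (Prod.snd :: vs.map fun g p => g p.1) p =
      size inp vs p.1 + p.2 := by
  rw [size_cons]
  simp [size, Function.comp_def]

/-- The value of an expression is polynomially bounded, so that unary numbers can afford it. -/
theorem exists_le_eval {α : Type} {inp : α → List Bool} {vs : List (α → ℕ)} {f : α → ℕ}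
    (h : Arith inp vs f) : ∃ P : Polynomial ℕ, ∀ a, f a ≤ P.eval (size inp vs a) := by
  induction h with
  | head g vs => exact ⟨Polynomial.X, fun a => by simp [size_cons]⟩
  | tail g _ ih =>
    obtain ⟨P, hP⟩ := ih
    exact ⟨P, fun a => (hP a).trans (P.eval_nat_mono (by simp [size_cons]))⟩
  | one => exact ⟨1, fun a => by simp⟩
  | length => exact ⟨Polynomial.X, fun a => by simp [size]⟩
  | bit _ _ => exact ⟨1, fun a => by simpa [bitAt] using Bool.toNat_le _⟩
  | add _ _ ih₁ ih₂ =>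
    obtain ⟨P, hP⟩ := ih₁
    obtain ⟨Q, hQ⟩ := ih₂
    exact ⟨P + Q, fun a => by simpa using Nat.add_le_add (hP a) (hQ a)⟩
  | sub _ _ ih₁ ih₂ =>
    obtain ⟨P, hP⟩ := ih₁
    exact ⟨P, fun a => (Nat.sub_le _ _).trans (hP a)⟩
  | @sum α inp vs b f _ _ ih₁ ih₂ =>
    obtain ⟨P, hP⟩ := ih₁
    obtain ⟨Q, hQ⟩ := ih₂
    refine ⟨P * Q.comp (Polynomial.X + P), fun a => ?_⟩
    have h : ∀ x ∈ Finset.range (b a),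
        f a x ≤ (Q.comp (Polynomial.X + P)).eval (size inp vs a) := by
      intro x hx
      refine (hQ (a, x)).trans ?_
      rw [size_prod, Polynomial.eval_comp, Polynomial.eval_add, Polynomial.eval_X]
      refine Q.eval_nat_mono (Nat.add_le_add_left ?_ _)
      exact (Finset.mem_range.1 hx).le.trans (hP a)
    refine (Finset.sum_le_card_nsmul _ _ _ h).trans ?_
    rw [Finset.card_range, smul_eq_mul, Polynomial.eval_mul]
    exact Nat.mul_le_mul_right _ (hP a)

open RegProgram

/-- The stacks before the evaluation of an expression: the input is on stack `0`, stack `1` is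
empty, the variables are in unary on the stacks `rs`, and the stacks from `d` on are empty. -/
structure Ready {α : Type} (inp : α → List Bool) (vs : List (α → ℕ)) (rs : List ℕ) (d : ℕ) (a : α)
    (s : ℕ → List Bool) : Prop where
  inp : s 0 = inp a
  tmp : s 1 = []
  vars : List.Forall₂ (fun g r => r < d ∧ s r = List.replicate (g a) true) vs rs
  free : ∀ i, d ≤ i → s i = []

theorem Ready.succ {α : Type} {inp : α → List Bool} {vs : List (α → ℕ)} {rs : List ℕ} {d : ℕ}
    {a : α} {s : ℕ → List Bool} (h : Ready inp vs rs d a s) (hd : 3 ≤ d) (l : List Bool) :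
    Ready inp vs rs (d + 1) a (Function.update s d l) where
  inp := by rw [Function.update_of_ne (by omega), h.inp]
  tmp := by rw [Function.update_of_ne (by omega), h.tmp]
  vars := h.vars.imp fun g r hr => ⟨by omega, by rw [Function.update_of_ne (by omega), hr.2]⟩
  free i hi := by rw [Function.update_of_ne (by omega), h.free i (by omega)]

/-- Every expression is evaluated by a register program in polynomial time; its value is left in
unary on the first free stack. -/
theorem exists_program {α : Type} {inp : α → List Bool} {vs : List (α → ℕ)} {f : α → ℕ}
    (h : Arith inp vs f) : ∃ (D : ℕ) (P : Polynomial ℕ), ∀ (N d : ℕ) (rs : List ℕ), 3 ≤ d →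
      d + D ≤ N → rs.length = vs.length → ∃ F : RegProgram N, ∀ a s, Ready inp vs rs d a s →
        F.Exec s (Function.update s d (List.replicate (f a) true)) (P.eval (size inp vs a)) := by
  induction h with
  | @head α inp g vs =>
    refine ⟨1, 6 * Polynomial.X + 2, fun N d rs hd hN hrs => ?_⟩
    obtain _ | ⟨r, rs⟩ := rs
    · simp at hrs
    by_cases hr : r < d
    · refine ⟨copy r d (d + 1), fun a s hs => ?_⟩
      obtain _ | ⟨⟨-, h⟩, -⟩ := hs.vars
      refine (exec_copy (by omega) (by omega) (by omega) (by omega) (by omega) (by omega) h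
        (hs.free _ le_rfl) (hs.free _ (by omega))).mono ?_
      simp [size_cons]
    -- no stacks are `Ready` if a variable is not below the free stacks
    · refine ⟨push 0 true, fun a s hs => ?_⟩
      obtain _ | ⟨⟨h, -⟩, -⟩ := hs.vars
      exact absurd h hr
  | @tail α inp g vs f _ ih =>
    obtain ⟨D, P, ih⟩ := ih
    refine ⟨D, P, fun N d rs hd hN hrs => ?_⟩
    obtain _ | ⟨r, rs⟩ := rs
    · simp at hrs
    obtain ⟨F, hF⟩ := ih N d rs hd hN (by simpa using hrs)
    refine ⟨F, fun a s hs => ?_⟩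
    have hs' : Ready inp vs rs d a s := by
      obtain ⟨h₀, h₁, h₂, h₃⟩ := hs
      obtain _ | ⟨-, h₂⟩ := h₂
      exact ⟨h₀, h₁, h₂, h₃⟩
    exact (hF a s hs').mono (P.eval_nat_mono (by simp [size_cons]))
  | one =>
    refine ⟨0, 1, fun N d rs hd hN hrs => ⟨push d true, fun a s hs => ?_⟩⟩
    exact (exec_push (by omega) true s).congr (by simp [hs.free]) (by simp)
  | length =>
    refine ⟨0, 4 * Polynomial.X + 2, fun N d rs hd hN hrs =>
      ⟨.seq (moveCount 0 1 d) (move 1 0), fun a s hs => ?_⟩⟩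
    have h₁ := exec_moveCount (N := N) (i := 0) (j := 1) (k := d) (by omega) (by omega) (by omega)
      (by omega) (by omega) (by omega) s
    refine (h₁.seq (exec_move (by omega) (by omega) (by omega) _)).congr ?_ ?_
    · funext y
      have h0 := hs.inp
      have h1 := hs.tmp
      have h2 := hs.free d le_rfl
      have h3 : 0 ≠ d := by omega
      have h4 : 1 ≠ d := by omega
      simp only [Function.update_apply]
      split_ifs <;> simp_all
    · have h4 : 1 ≠ d := by omega
      simp [h4, hs.inp, hs.tmp, size]
      omega
  | @bit α inp vs f hf ih =>
    obtain ⟨D, P, ih⟩ := ih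
    obtain ⟨Q, hQ⟩ := hf.exists_le_eval
    refine ⟨D, P + (3 * Q + 1) + 1 + (2 * Q + 1), fun N d rs hd hN hrs => ?_⟩
    obtain ⟨F, hF⟩ := ih N d rs hd hN hrs
    -- move `f a` symbols of the input away to find the bit on top, and move them back
    refine ⟨.seq (.seq (.seq F (forLoop d (shift 0 1))) (peekTrue 0 d)) (move 1 0),
      fun a s hs => ?_⟩
    let J : ℕ → ℕ → List Bool := fun x => Function.update (Function.update (Function.update s d
      (List.replicate x true)) 0 ((inp a).drop (f a - x))) 1 ((inp a).take (f a - x)).reverse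
    have hd0 : d ≠ 0 := by omega
    have hd1 : d ≠ 1 := by omega
    have h0 := hs.inp
    have h1 := hs.tmp
    have hJ : J (f a) = Function.update s d (List.replicate (f a) true) := by
      funext y
      simp only [J, Function.update_apply]
      split_ifs <;> simp_all
    have h₁ : (forLoop d (shift 0 1) : RegProgram N).Exec (J (f a)) (J 0) (f a * (1 + 2) + 1) := by
      refine exec_forLoop (by omega) J _ 1 (fun x => by simp [J, hd0, hd1]) fun x hx => ?_
      have e : f a - x = f a - (x + 1) + 1 := by omega
      rcases Nat.lt_or_ge (f a - (x + 1)) (inp a).length with hlt | hge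
      · refine (exec_shift_cons (by omega) (by omega) (by omega) _
          (b := (inp a)[f a - (x + 1)]) (l := (inp a).drop (f a - x)) ?_).congr ?_ le_rfl
        · simp only [J, Function.update_apply, hd0.symm, if_false, zero_ne_one, if_true]
          rw [e, List.drop_eq_getElem_cons hlt]
        · have e' : ((inp a).take (f a - x)).reverse =
              (inp a)[f a - (x + 1)] :: ((inp a).take (f a - (x + 1))).reverse := by
            rw [e, List.take_succ_eq_append_getElem hlt, List.reverse_append]
            rfl
          funext y
          simp only [J, Function.update_apply, e']
          split_ifs <;> simp_all
      · refine (exec_shift_nil (by omega) _ _ ?_).congr ?_ le_rfl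
        · simp only [J, Function.update_apply, hd0.symm, if_false, zero_ne_one, if_true]
          exact List.drop_eq_nil_of_le hge
        · funext y
          simp only [J, Function.update_apply]
          rw [List.take_of_length_le hge, List.take_of_length_le (show _ ≤ f a - x by omega),
            List.drop_eq_nil_of_le hge, List.drop_eq_nil_of_le (show _ ≤ f a - x by omega)]
          split_ifs <;> simp_all
    rw [hJ] at h₁
    refine ((((hF a s hs).seq h₁).seq (exec_peekTrue (by omega) (by omega) _)).seq
      (exec_move (by omega) (by omega) (by omega) _)).congr ?_ ?_
    · have e : ((inp a).drop (f a)).head? = (inp a)[f a]? := by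
        rw [List.head?_drop]
      funext y
      simp only [J, Function.update_apply, bitAt, ← e]
      split_ifs <;> simp_all
    · have := hQ a
      simp [J, hd1.symm]
      omega
  | @add α inp vs f g hf hg ihf ihg =>
    obtain ⟨D, P, ihf⟩ := ihf
    obtain ⟨D', P', ihg⟩ := ihg
    obtain ⟨Q, hQ⟩ := hg.exists_le_eval
    refine ⟨D + D' + 1, P + P' + (2 * Q + 1), fun N d rs hd hN hrs => ?_⟩
    obtain ⟨F, hF⟩ := ihf N d rs hd (by omega) hrs
    obtain ⟨G, hG⟩ := ihg N (d + 1) rs (by omega) (by omega) hrs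
    refine ⟨.seq (.seq F G) (move (d + 1) d), fun a s hs => ?_⟩
    have h1 := hs.free (d + 1) (by omega)
    refine (((hF a s hs).seq (hG a _ (hs.succ hd _))).seq
      (exec_move (by omega) (by omega) (by omega) _)).congr ?_ ?_
    · funext y
      rcases eq_or_ne y d with rfl | hy
      · simp [add_comm]
      · rcases eq_or_ne y (d + 1) with rfl | hy'
        · simp [h1]
        · simp [hy, hy']
    · have := hQ a
      simp
      omega
  | @sub α inp vs f g hf hg ihf ihg =>
    obtain ⟨D, P, ihf⟩ := ihf
    obtain ⟨D', P', ihg⟩ := ihg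
    obtain ⟨Q, hQ⟩ := hg.exists_le_eval
    refine ⟨D + D' + 1, P + P' + (3 * Q + 1), fun N d rs hd hN hrs => ?_⟩
    obtain ⟨F, hF⟩ := ihf N d rs hd (by omega) hrs
    obtain ⟨G, hG⟩ := ihg N (d + 1) rs (by omega) (by omega) hrs
    -- popping the empty stack has no effect, which is truncation
    refine ⟨.seq (.seq F G) (forLoop (d + 1) (pop d)), fun a s hs => ?_⟩
    have h1 := hs.free (d + 1) (by omega)
    let J : ℕ → ℕ → List Bool := fun x => Function.update (Function.update s d
      (List.replicate (f a - (g a - x)) true)) (d + 1) (List.replicate x true)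
    have h₁ : (forLoop (d + 1) (pop d) : RegProgram N).Exec (J (g a)) (J 0)
        (g a * (1 + 2) + 1) := by
      refine exec_forLoop (by omega) J _ 1 (fun x => by simp [J]) fun x hx => ?_
      refine (exec_pop (by omega) _).congr ?_ le_rfl
      have e : f a - (g a - x) = f a - (g a - (x + 1)) - 1 := by omega
      funext y
      rcases eq_or_ne y d with rfl | hy
      · simp [J, e]
      · rcases eq_or_ne y (d + 1) with rfl | hy'
        · simp [J]
        · simp [J, hy, hy']
    have hJ : J (g a) = Function.update (Function.update s d (List.replicate (f a) true)) (d + 1)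
        (List.replicate (g a) true) := by
      simp [J]
    rw [hJ] at h₁
    refine (((hF a s hs).seq (hG a _ (hs.succ hd _))).seq h₁).congr ?_ ?_
    · funext y
      rcases eq_or_ne y d with rfl | hy
      · simp [J]
      · rcases eq_or_ne y (d + 1) with rfl | hy'
        · simp [J, h1]
        · simp [J, hy, hy']
    · have := hQ a
      simp
      omega
  | @sum α inp vs b f hb hf ihb ihf =>
    obtain ⟨D, P, ihb⟩ := ihb
    obtain ⟨D', P', ihf⟩ := ihf
    obtain ⟨Q, hQ⟩ := hb.exists_le_eval
    obtain ⟨Q', hQ'⟩ := hf.exists_le_eval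
    obtain ⟨R, hR⟩ := (hb.sum hf).exists_le_eval
    let T : Polynomial ℕ := P'.comp (Polynomial.X + Q) + (2 * Q'.comp (Polynomial.X + Q) + 1)
    refine ⟨D + D' + 2, P + (Q * (T + 2) + 1) + (2 * R + 1), fun N d rs hd hN hrs => ?_⟩
    obtain ⟨F, hF⟩ := ihb N d rs hd (by omega) hrs
    obtain ⟨G, hG⟩ := ihf N (d + 2) (d :: rs) (by omega) (by omega) (by simpa using hrs)
    -- the loop counter on stack `d` is the summation variable, running down from `b a - 1`, and
    -- stack `d + 1` accumulates the sum
    refine ⟨.seq (.seq F (forLoop d (.seq G (move (d + 2) (d + 1))))) (move (d + 1) d),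
      fun a s hs => ?_⟩
    have h1 := hs.free (d + 1) (by omega)
    have h2 := hs.free (d + 2) (by omega)
    let J : ℕ → ℕ → List Bool := fun x => Function.update (Function.update s d
      (List.replicate x true)) (d + 1) (List.replicate (∑ y ∈ Finset.Ico x (b a), f a y) true)
    have hlt : ∀ x < b a, size inp vs a + x ≤ (Polynomial.X + Q).eval (size inp vs a) := by
      intro x hx
      simpa using (hx.le.trans (hQ a))
    have h₁ : (forLoop d (.seq G (move (d + 2) (d + 1))) : RegProgram N).Exec (J (b a)) (J 0)
        (b a * (T.eval (size inp vs a) + 2) + 1) := by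
      refine exec_forLoop (by omega) J _ _ (fun x => by simp [J]) fun x hx => ?_
      have hready : Ready (fun p : α × ℕ => inp p.1) (Prod.snd :: vs.map fun g p => g p.1)
          (d :: rs) (d + 2) (a, x)
          (Function.update (J (x + 1)) d (List.replicate x true)) := by
        refine ⟨?_, ?_, ?_, ?_⟩
        · simp only [J]
          rw [Function.update_of_ne (by omega), Function.update_of_ne (by omega),
            Function.update_of_ne (by omega), hs.inp]
        · simp only [J]
          rw [Function.update_of_ne (by omega), Function.update_of_ne (by omega),
            Function.update_of_ne (by omega), hs.tmp]
        · refine List.Forall₂.cons ⟨by omega, by simp⟩ ?_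
          rw [List.forall₂_map_left_iff]
          refine hs.vars.imp fun g r hr => ⟨by omega, ?_⟩
          simp only [J]
          rw [Function.update_of_ne (by omega), Function.update_of_ne (by omega),
            Function.update_of_ne (by omega), hr.2]
        · intro i hi
          simp only [J]
          rw [Function.update_of_ne (by omega), Function.update_of_ne (by omega),
            Function.update_of_ne (by omega), hs.free i (by omega)]
      refine ((hG (a, x) _ hready).seq
        (exec_move (by omega) (by omega) (by omega) _)).congr ?_ ?_
      · have e : ∑ y ∈ Finset.Ico x (b a), f a y =
            f a x + ∑ y ∈ Finset.Ico (x + 1) (b a), f a y :=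
          Finset.sum_eq_sum_Ico_succ_bot hx _
        funext y
        rcases eq_or_ne y d with rfl | hy
        · simp [J]
        · rcases eq_or_ne y (d + 1) with rfl | hy'
          · simp [J, e]
          · rcases eq_or_ne y (d + 2) with rfl | hy''
            · simp [J, h2]
            · simp [J, hy, hy', hy'']
      · have h3 := P'.eval_nat_mono (hlt x hx)
        have h4 := (hQ' (a, x)).trans (Q'.eval_nat_mono ((size_prod inp vs (a, x)).le.trans
          (hlt x hx)))
        simp only [size_prod, Function.update_self, List.length_replicate, T, Polynomial.eval_add,
          Polynomial.eval_comp, Polynomial.eval_mul, Polynomial.eval_one,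
          Polynomial.eval_ofNat] at h3 h4 ⊢
        omega
    have hJ : J (b a) = Function.update s d (List.replicate (b a) true) := by
      funext y
      rcases eq_or_ne y (d + 1) with rfl | hy
      · simp [J, h1]
      · simp [J, hy]
    rw [hJ] at h₁
    refine (((hF a s hs).seq h₁).seq (exec_move (by omega) (by omega) (by omega) _)).congr ?_ ?_
    · funext y
      rcases eq_or_ne y d with rfl | hy
      · simp [J]
      · rcases eq_or_ne y (d + 1) with rfl | hy'
        · simp [J, h1]
        · simp [J, hy, hy']
    · have h3 := hR a
      have h4 := Nat.mul_le_mul_right (T.eval (size inp vs a) + 2) (hQ a)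
      simp only [J, Function.update_self, List.length_replicate, Polynomial.eval_add,
        Polynomial.eval_mul, Polynomial.eval_one, Polynomial.eval_ofNat,
        ← Finset.range_eq_Ico] at h3 h4 ⊢
      omega

end Arith

end Turing

/-! ### Lists given by arithmetic expressions -/

namespace Turing

namespace Arith

open RegProgram

/-- The machine of a register program, with input on stack `0` and output on stack `2`. -/
def machine {N : ℕ} (F : RegProgram N) : FinTM2 where
  K := Fin (N + 1)
  k₀ := reg 0
  k₁ := reg 2
  Γ _ := Bool
  Λ := F.Λ
  main := F.entry
  σ := Option Bool
  initialState := none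
  Γk₀Fin := inferInstanceAs (Fintype Bool)
  m := F.code

/-- Lists whose length and entries are given by expressions are computable in polynomial time. The
entries are produced from the last one to the first one. -/
theorem nonempty_polyTime {α : Type} {inp : α → List Bool} {len : α → ℕ} {g : α → ℕ → ℕ}
    (hlen : Arith inp [] len)
    (hg : Arith (fun p : α × ℕ => inp p.1) [Prod.snd] (fun p => g p.1 p.2))
    {out : α → List Bool}
    (hout : ∀ a, out a = (List.range (len a)).map fun k => decide (g a k ≠ 0)) :
    Nonempty (TM2ComputableInPolyTime inp (id : List Bool → List Bool) out) := by
  obtain ⟨D, P, hF⟩ := hlen.exists_program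
  obtain ⟨D', P', hG⟩ := hg.exists_program
  obtain ⟨Q, hQ⟩ := hlen.exists_le_eval
  obtain ⟨Q', hQ'⟩ := hg.exists_le_eval
  let N := D + D' + 5
  obtain ⟨F, hF⟩ := hF N 3 [] le_rfl (by omega) rfl
  obtain ⟨G, hG⟩ := hG N 4 [3] (by omega) (by omega) rfl
  let prog : RegProgram N := .seq (.seq F (forLoop 3 (.seq (.seq G (pushNonempty 4 2)) (clear 4))))
    (clear 0)
  let T : Polynomial ℕ := P'.comp (Polynomial.X + Q) + 1 +
    (2 * Q'.comp (Polynomial.X + Q) + 1)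
  let time : Polynomial ℕ := P + (Q * (T + 2) + 1) + (2 * Polynomial.X + 1)
  have hsize : ∀ a, size inp [] a = (inp a).length := fun a => by simp [size]
  have hrun : ∀ a, prog.Exec (Function.update (fun _ => []) 0 (inp a))
      (Function.update (fun _ => []) 2 (out a)) (time.eval (inp a).length) := by
    intro a
    let J : ℕ → ℕ → List Bool := fun x => Function.update (Function.update (Function.update
      (fun _ => []) 0 (inp a)) 3 (List.replicate x true)) 2
      ((List.range' x (len a - x)).map fun k => decide (g a k ≠ 0))
    have hready : Ready inp [] [] 3 a (Function.update (fun _ => []) 0 (inp a)) :=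
      ⟨by simp, by simp, .nil, fun i hi => by rw [Function.update_of_ne (by omega)]⟩
    have h₁ := hF a _ hready
    have hJ : J (len a) = Function.update (Function.update (fun _ => []) 0 (inp a)) 3
        (List.replicate (len a) true) := by
      funext y
      rcases eq_or_ne y 2 with rfl | hy
      · simp [J]
      · simp [J, hy]
    have h₂ : (forLoop 3 (.seq (.seq G (pushNonempty 4 2)) (clear 4)) : RegProgram N).Exec
        (J (len a)) (J 0) (len a * (T.eval (inp a).length + 2) + 1) := by
      refine exec_forLoop (by omega) J _ _ (fun x => by simp [J]) fun x hx => ?_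
      have hready' : Ready (fun p : α × ℕ => inp p.1) [Prod.snd] [3] 4 (a, x)
          (Function.update (J (x + 1)) 3 (List.replicate x true)) := by
        refine ⟨by simp [J], by simp [J], .cons ⟨by omega, by simp⟩ .nil, fun i hi => ?_⟩
        simp only [J]
        rw [Function.update_of_ne (by omega), Function.update_of_ne (by omega),
          Function.update_of_ne (by omega), Function.update_of_ne (by omega)]
      refine (((hG (a, x) _ hready').seq (exec_pushNonempty (by omega) (by omega) _)).seq
        (exec_clear (by omega) _)).congr ?_ ?_
      · have e : len a - x = len a - (x + 1) + 1 := by omega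
        have e' : ((List.replicate (g a x) true).head?).isSome = decide (g a x ≠ 0) := by
          cases g a x <;> simp [List.replicate_succ]
        funext y
        rcases eq_or_ne y 2 with rfl | hy
        · simp only [J]
          rw [e, List.range'_succ, List.map_cons, Function.update_of_ne (by omega),
            Function.update_self, Function.update_self, Function.update_self, e',
            Function.update_of_ne (by omega), Function.update_of_ne (by omega),
            Function.update_self]
        · rcases eq_or_ne y 3 with rfl | hy'
          · simp [J]
          · rcases eq_or_ne y 4 with rfl | hy''
            · simp [J]
            · simp [J, hy, hy', hy'']
      · have hlt : size (fun p : α × ℕ => inp p.1) [Prod.snd] (a, x) ≤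
            (Polynomial.X + Q).eval (inp a).length := by
          have := hQ a
          rw [hsize] at this
          simp [size]
          omega
        have h3 := P'.eval_nat_mono hlt
        have h4 := (hQ' (a, x)).trans (Q'.eval_nat_mono hlt)
        dsimp only at h3 h4
        rw [Function.update_of_ne (by omega), Function.update_self, List.length_replicate]
        simp only [T, Polynomial.eval_add, Polynomial.eval_comp, Polynomial.eval_mul,
          Polynomial.eval_one, Polynomial.eval_ofNat] at h3 h4 ⊢
        omega
    rw [hJ] at h₂
    refine ((h₁.seq h₂).seq (exec_clear (by omega) _)).congr ?_ ?_
    · funext y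
      rw [hout a, List.range_eq_range']
      rcases eq_or_ne y 2 with rfl | hy
      · simp [J]
      · rcases eq_or_ne y 0 with rfl | hy'
        · simp [J]
        · rcases eq_or_ne y 3 with rfl | hy''
          · simp [J]
          · simp [J, hy, hy', hy'']
    · have h3 := hQ a
      rw [hsize] at h3 ⊢
      have h4 := Nat.mul_le_mul_right (T.eval (inp a).length + 2) h3
      have h5 : J 0 0 = inp a := by simp [J]
      rw [h5]
      simp only [time, Polynomial.eval_add, Polynomial.eval_mul, Polynomial.eval_one,
        Polynomial.eval_ofNat, Polynomial.eval_X] at h4 ⊢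
      omega
  have hout' : ∀ a, Nonempty (TM2OutputsInTime (machine prog)
      ((inp a).map (Equiv.refl Bool).symm) (some ((out a).map (Equiv.refl Bool).symm))
      (time.eval (inp a).length)) := by
    intro a
    refine FinTM2.nonempty_outputsInTime _ ?_
    have h := hrun a
    have e₀ := update_reg (N := N) (fun _ => []) (i := 0) (by omega) (inp a)
    have e₂ := update_reg (N := N) (fun _ => []) (i := 2) (by omega) (out a)
    rw [Exec, ← e₀, ← e₂] at h
    have h' : prog.Runs none
        (Function.update (fun _ => []) (reg 0) ((inp a).map (Equiv.refl Bool).symm)) none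
        (Function.update (fun _ => []) (reg 2) ((out a).map (Equiv.refl Bool).symm))
        (time.eval (inp a).length) := by
      simpa using h
    exact h'
  exact ⟨{
    tm := machine prog
    inputAlphabet := Equiv.refl Bool
    outputAlphabet := Equiv.refl Bool
    time := time
    outputsFun := fun a => (hout' a).some }⟩

/-! ### Derived arithmetic operations and predicates -/

section Derived

variable {α : Type} {inp : α → List Bool} {vs : List (α → ℕ)} {f g : α → ℕ}

theorem congr (h : Arith inp vs f) (e : ∀ a, f a = g a) : Arith inp vs g :=
  funext e ▸ h

/-- Substitution for the variables and the input. -/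
theorem comp (h : Arith inp vs f) {β : Type} (φ : β → α) :
    Arith (fun b => inp (φ b)) (vs.map fun g b => g (φ b)) (fun b => f (φ b)) := by
  induction h generalizing β with
  | head g vs => exact .head _ _
  | tail g _ ih => exact .tail _ (ih φ)
  | one => exact .one
  | length => exact .length
  | bit _ ih => exact .bit (ih φ)
  | add _ _ ih₁ ih₂ => exact .add (ih₁ φ) (ih₂ φ)
  | sub _ _ ih₁ ih₂ => exact .sub (ih₁ φ) (ih₂ φ)
  | sum _ _ ih₁ ih₂ =>
    refine .sum (ih₁ φ) ?_
    have h := ih₂ fun p : β × ℕ => (φ p.1, p.2)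
    simp only [List.map_cons, List.map_map, Function.comp_def] at h ⊢
    exact h

theorem var (h : g ∈ vs) : Arith inp vs g := by
  induction vs with
  | nil => simp at h
  | cons f vs ih =>
    rcases List.mem_cons.1 h with rfl | h
    · exact .head _ _
    · exact .tail _ (ih h)

theorem mono {vs' : List (α → ℕ)} (h : Arith inp vs f) (hvs : vs ⊆ vs') : Arith inp vs' f := by
  induction h with
  | head g vs => exact .var (hvs (List.mem_cons_self ..))
  | tail g _ ih => exact ih fun x hx => hvs (List.mem_cons_of_mem _ hx)
  | one => exact .one
  | length => exact .length
  | bit _ ih => exact .bit (ih hvs)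
  | add _ _ ih₁ ih₂ => exact .add (ih₁ hvs) (ih₂ hvs)
  | sub _ _ ih₁ ih₂ => exact .sub (ih₁ hvs) (ih₂ hvs)
  | sum _ _ ih₁ ih₂ => exact .sum (ih₁ hvs) (ih₂ (List.cons_subset_cons _ (List.map_subset _ hvs)))

/-- An expression remains an expression under a bounded sum. -/
theorem weaken (h : Arith inp vs f) :
    Arith (fun p : α × ℕ => inp p.1) (Prod.snd :: vs.map fun g p => g p.1) (fun p => f p.1) :=
  .tail _ (h.comp Prod.fst)

/-- The summation variable. -/
theorem snd : Arith (fun p : α × ℕ => inp p.1) (Prod.snd :: vs.map fun g p => g p.1) Prod.snd :=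
  .head _ _

theorem const (n : ℕ) : Arith inp vs fun _ => n := by
  induction n with
  | zero => exact (one.sub one).congr fun _ => rfl
  | succ n ih => exact ih.add one

theorem mul (hf : Arith inp vs f) (hg : Arith inp vs g) : Arith inp vs fun a => f a * g a :=
  (hf.sum (f := fun a _ => g a) hg.weaken).congr fun a => by simp

end Derived

end Arith

open Classical in
/-- A predicate whose truth value is given by an expression. -/
def ArithPred {α : Type} (inp : α → List Bool) (vs : List (α → ℕ)) (p : α → Prop) : Prop :=
  Arith inp vs fun a => if p a then 1 else 0

namespace ArithPred

variable {α : Type} {inp : α → List Bool} {vs : List (α → ℕ)} {f g : α → ℕ} {p q : α → Prop}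

theorem congr (h : ArithPred inp vs p) (e : ∀ a, p a ↔ q a) : ArithPred inp vs q :=
  (funext fun a => propext (e a) : p = q) ▸ h

theorem le (hf : Arith inp vs f) (hg : Arith inp vs g) : ArithPred inp vs fun a => f a ≤ g a :=
  (Arith.one.sub (hf.sub hg)).congr fun a => by split_ifs <;> omega

theorem not (hp : ArithPred inp vs p) : ArithPred inp vs fun a => ¬ p a :=
  (Arith.one.sub hp).congr fun a => by by_cases h : p a <;> simp [h]

theorem lt (hf : Arith inp vs f) (hg : Arith inp vs g) : ArithPred inp vs fun a => f a < g a :=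
  (le hg hf).not.congr fun _ => not_le

theorem and (hp : ArithPred inp vs p) (hq : ArithPred inp vs q) :
    ArithPred inp vs fun a => p a ∧ q a :=
  (Arith.mul hp hq).congr fun a => by by_cases h : p a <;> by_cases h' : q a <;> simp [h, h']

theorem or (hp : ArithPred inp vs p) (hq : ArithPred inp vs q) :
    ArithPred inp vs fun a => p a ∨ q a :=
  (hp.not.and hq.not).not.congr fun a => by tauto

theorem eq (hf : Arith inp vs f) (hg : Arith inp vs g) : ArithPred inp vs fun a => f a = g a :=
  ((le hf hg).and (le hg hf)).congr fun _ => le_antisymm_iff.symm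

theorem bit (hf : Arith inp vs f) : ArithPred inp vs fun a => (inp a)[f a]? = some true :=
  (Arith.bit hf).congr fun a => by
    rcases h : (inp a)[f a]? with _ | b
    · simp [bitAt, h]
    · cases b <;> simp [bitAt, h]

theorem ballLt {b : α → ℕ} {p : α → ℕ → Prop} (hb : Arith inp vs b)
    (hp : ArithPred (fun q : α × ℕ => inp q.1) (Prod.snd :: vs.map fun g q => g q.1)
      (fun q => p q.1 q.2)) : ArithPred inp vs fun a => ∀ x < b a, p a x := by
  classical
  have h : Arith (fun q : α × ℕ => inp q.1) (Prod.snd :: vs.map fun g q => g q.1)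
      (fun q => if ¬ p q.1 q.2 then 1 else 0) := Arith.congr hp.not fun _ => by congr
  exact (eq (hb.sum (f := fun a x => if ¬ p a x then 1 else 0) h) (.const 0)).congr fun a => by
    simp

end ArithPred

namespace Arith

variable {α : Type} {inp : α → List Bool} {vs : List (α → ℕ)} {f g : α → ℕ}

/-- The quotient is the number of positive multiples of the divisor up to the dividend. -/
theorem div (hf : Arith inp vs f) (hg : Arith inp vs g) (hpos : ∀ a, 0 < g a) :
    Arith inp vs fun a => f a / g a := by
  refine (hf.sum (f := fun a q => if (q + 1) * g a ≤ f a then 1 else 0)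
    (congr (ArithPred.le ((snd.add one).mul hg.weaken) hf.weaken) fun _ => by congr)).congr
    fun a => ?_
  have e : (Finset.range (f a)).filter (fun q => (q + 1) * g a ≤ f a) =
      Finset.range (f a / g a) := by
    ext q
    rw [Finset.mem_filter, Finset.mem_range, Finset.mem_range, ← Nat.le_div_iff_mul_le (hpos a)]
    have := Nat.div_le_self (f a) (g a)
    omega
  rw [Finset.sum_boole, e, Finset.card_range, Nat.cast_id]

theorem mod (hf : Arith inp vs f) (hg : Arith inp vs g) (hpos : ∀ a, 0 < g a) :
    Arith inp vs fun a => f a % g a :=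
  (hf.sub (hg.mul (hf.div hg hpos))).congr fun a => by
    have := Nat.div_add_mod (f a) (g a)
    omega

open Classical in
/-- The least number below `b` satisfying `p`, and `b` if there is none, as the number of `x < b`
such that `p` fails up to `x`. -/
noncomputable def _root_.Turing.leastBelow (b : ℕ) (p : ℕ → Prop) : ℕ :=
  ∑ x ∈ Finset.range b, if ∀ y < x + 1, ¬ p y then 1 else 0

theorem _root_.Turing.leastBelow_spec {b : ℕ} {p : ℕ → Prop} (h : ∃ y < b, p y) :
    leastBelow b p < b ∧ p (leastBelow b p) := by
  classical
  have h' : ∃ y, p y := h.imp fun _ hy => hy.2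
  obtain ⟨y, hyb, hy⟩ := h
  have hle := Nat.find_min' h' hy
  have e : leastBelow b p = Nat.find h' := by
    have e' : (Finset.range b).filter (fun x => ∀ y < x + 1, ¬ p y) =
        Finset.range (Nat.find h') := by
      ext x
      rw [Finset.mem_filter, Finset.mem_range, Finset.mem_range, Nat.lt_find_iff]
      refine ⟨fun h z hz => h.2 z (by omega), fun h => ⟨?_, fun z hz => h z (by omega)⟩⟩
      by_contra hx
      exact h y (by omega) hy
    rw [leastBelow, ← Finset.card_range (Nat.find h'), ← e', Finset.card_filter]
  rw [e]
  exact ⟨by omega, Nat.find_spec h'⟩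

theorem least {b : α → ℕ} {p : α → ℕ → Prop} (hb : Arith inp vs b)
    (hp : ArithPred (fun q : α × ℕ => inp q.1) (Prod.snd :: vs.map fun g q => g q.1)
      (fun q => p q.1 q.2)) : Arith inp vs fun a => leastBelow (b a) (p a) := by
  classical
  unfold leastBelow
  refine hb.sum (f := fun a x => if ∀ y < x + 1, ¬ p a y then 1 else 0) ?_
  have hp' : ArithPred (fun r : (α × ℕ) × ℕ => inp r.1.1)
      (Prod.snd :: (Prod.snd :: vs.map fun g q => g q.1).map fun g r => g r.1)
      (fun r => p r.1.1 r.2) := by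
    refine (Arith.comp hp fun r : (α × ℕ) × ℕ => (r.1.1, r.2)).mono ?_
    simp only [List.map_cons, List.map_map, Function.comp_def]
    intro g hg
    simp only [List.mem_cons] at hg ⊢
    tauto
  exact Arith.congr (ArithPred.ballLt (p := fun (q : α × ℕ) y => ¬ p q.1 y) (snd.add one)
    hp'.not) fun _ => by congr

end Arith

end Turing

/-! ### The graph of the reduction -/

namespace MEG

section Walks

variable {V : Type} {G : SimpleGraph V} {u v x y : V}

theorem monitors_of_adj (h : G.Adj u v) : Monitors G u v u v := by
  intro p hp
  rw [SimpleGraph.dist_eq_one_iff_adj.2 h] at hp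
  obtain _ | ⟨h', p⟩ := p
  · simp at hp
  obtain _ | ⟨h'', p⟩ := p
  · simp
  · simp at hp

/-- A pair of vertices at distance two with a single common neighbour monitors both edges of its
shortest path. -/
theorem monitors_of_unique {m : V} (hxm : G.Adj x m) (hmy : G.Adj m y) (hne : x ≠ y)
    (hxy : ¬ G.Adj x y) (huniq : ∀ m', G.Adj x m' → G.Adj m' y → m' = m) :
    Monitors G x y x m ∧ Monitors G x y m y := by
  have key : ∀ p : G.Walk x y, p.length = G.dist x y → p.edges = [s(x, m), s(m, y)] := by
    intro p hp
    have hd : G.dist x y ≤ 2 := SimpleGraph.dist_le (.cons hxm (.cons hmy .nil))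
    rw [← hp] at hd
    obtain _ | ⟨h₁, p⟩ := p
    · exact absurd rfl hne
    obtain _ | ⟨h₂, p⟩ := p
    · exact absurd h₁ hxy
    obtain _ | ⟨h₃, p⟩ := p
    · obtain rfl := huniq _ h₁ h₂
      simp
    · simp at hd
  exact ⟨fun p hp => by simp [key p hp], fun p hp => by simp [key p hp]⟩

theorem exists_split_of_mem_edges (p : G.Walk x y) (h : s(u, v) ∈ p.edges) :
    (∃ (p₁ : G.Walk x u) (p₂ : G.Walk v y), p.length = p₁.length + 1 + p₂.length) ∨
    (∃ (p₁ : G.Walk x v) (p₂ : G.Walk u y), p.length = p₁.length + 1 + p₂.length) := by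
  induction p with
  | nil => simp at h
  | cons h' p ih =>
    rw [SimpleGraph.Walk.edges_cons, List.mem_cons] at h
    rcases h with h | h
    · rcases Sym2.eq_iff.1 h with ⟨rfl, rfl⟩ | ⟨rfl, rfl⟩
      · exact .inl ⟨.nil, p, by simp; omega⟩
      · exact .inr ⟨.nil, p, by simp; omega⟩
    · rcases ih h with ⟨p₁, p₂, e⟩ | ⟨p₁, p₂, e⟩
      · exact .inl ⟨.cons h' p₁, p₂, by simp; omega⟩
      · exact .inr ⟨.cons h' p₁, p₂, by simp; omega⟩

theorem exists_concat (p : G.Walk x u) (h : x ≠ u) :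
    ∃ (a : V) (p' : G.Walk x a), G.Adj a u ∧ p.length = p'.length + 1 := by
  obtain ⟨q, hq⟩ : ∃ q : G.Walk u x, q.length = p.length := ⟨p.reverse, by simp⟩
  obtain _ | ⟨h', q⟩ := q
  · exact absurd rfl h
  · exact ⟨_, q.reverse, h'.symm, by rw [← hq]; simp⟩

/-- If the middle edge `uv` of every path `a, u, v, b` can be avoided by a walk from `a` to `b`
that is not longer, then a shortest path through `uv` that neither starts nor ends on `uv` can be
rerouted, so that only pairs containing `u` or `v` monitor `uv`. -/
theorem eq_or_eq_of_monitors (huv : G.Adj u v)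
    (hex : ∀ a b, G.Adj a u → G.Adj v b → a ≠ v → b ≠ u →
      ∃ q : G.Walk a b, q.length ≤ 3 ∧ s(u, v) ∉ q.edges)
    (hmon : Monitors G x y u v) (p₁ : G.Walk x u) (p₂ : G.Walk v y)
    (hp : G.dist x y = p₁.length + 1 + p₂.length) : x = u ∨ y = v := by
  by_contra! hne
  obtain ⟨a, q₁, ha, e₁⟩ := exists_concat p₁ hne.1
  obtain ⟨b, q₂, hb, e₂⟩ : ∃ (b : V) (q₂ : G.Walk b y), G.Adj v b ∧
      p₂.length = q₂.length + 1 := by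
    obtain _ | ⟨h', q⟩ := p₂
    · exact absurd rfl hne.2
    · exact ⟨_, q, h', by simp⟩
  have hav : a ≠ v := by
    rintro rfl
    have := SimpleGraph.dist_le (q₁.append p₂)
    rw [SimpleGraph.Walk.length_append] at this
    omega
  have hbu : b ≠ u := by
    rintro rfl
    have := SimpleGraph.dist_le (p₁.append q₂)
    rw [SimpleGraph.Walk.length_append] at this
    omega
  obtain ⟨q, hq, hq'⟩ := hex a b ha hb hav hbu
  have hlen : (q₁.append (q.append q₂)).length = G.dist x y := by
    refine le_antisymm ?_ (SimpleGraph.dist_le _)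
    simp only [SimpleGraph.Walk.length_append]
    omega
  have hmem := hmon _ hlen
  simp only [SimpleGraph.Walk.edges_append, List.mem_append, hq', false_or] at hmem
  classical
  rcases hmem with hmem | hmem
  · have hu := q₁.fst_mem_support_of_mem_edges hmem
    have h₁ := q₁.length_takeUntil_le_length hu
    have := SimpleGraph.dist_le ((q₁.takeUntil u hu).append (.cons huv p₂))
    rw [SimpleGraph.Walk.length_append, SimpleGraph.Walk.length_cons] at this
    omega
  · have hv := q₂.snd_mem_support_of_mem_edges hmem
    have h₁ := q₂.length_dropUntil_le_length hv
    have := SimpleGraph.dist_le (p₁.append (.cons huv (q₂.dropUntil v hv)))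
    rw [SimpleGraph.Walk.length_append, SimpleGraph.Walk.length_cons] at this
    omega

/-- An edge around which all paths can be rerouted has an end in every MEG-set. -/
theorem mem_of_monitors (hG : G.Connected) (huv : G.Adj u v)
    (hex : ∀ a b, G.Adj a u → G.Adj v b → a ≠ v → b ≠ u →
      ∃ q : G.Walk a b, q.length ≤ 3 ∧ s(u, v) ∉ q.edges)
    (hex' : ∀ a b, G.Adj a v → G.Adj u b → a ≠ u → b ≠ v →
      ∃ q : G.Walk a b, q.length ≤ 3 ∧ s(v, u) ∉ q.edges)
    {M : Set V} (hM : IsMEGSet G M) : u ∈ M ∨ v ∈ M := by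
  obtain ⟨x, hx, y, hy, hmon⟩ := hM u v huv
  obtain ⟨p, hp⟩ := hG.exists_walk_length_eq_dist x y
  rcases exists_split_of_mem_edges p (hmon p hp) with ⟨p₁, p₂, e⟩ | ⟨p₁, p₂, e⟩
  · rcases eq_or_eq_of_monitors huv hex hmon p₁ p₂ (hp ▸ e) with rfl | rfl
    exacts [.inl hx, .inr hy]
  · have hmon' : Monitors G x y v u := fun p hp => Sym2.eq_swap ▸ hmon p hp
    rcases eq_or_eq_of_monitors huv.symm hex' hmon' p₁ p₂ (hp ▸ e) with rfl | rfl
    exacts [.inr hx, .inl hy]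

theorem IsMEGSet.of_iso {V' : Type} {G' : SimpleGraph V'} (φ : G ≃g G') {M : Set V'}
    (h : IsMEGSet G' M) : IsMEGSet G (φ ⁻¹' M) := by
  intro u v huv
  obtain ⟨x, hx, y, hy, hmon⟩ := h (φ u) (φ v) (φ.map_adj_iff.2 huv)
  refine ⟨φ.symm x, by simpa using hx, φ.symm y, by simpa using hy, fun p hp => ?_⟩
  have hd : G'.dist x y = G.dist (φ.symm x) (φ.symm y) := by
    rw [SimpleGraph.dist_eq_sInf, SimpleGraph.dist_eq_sInf]
    congr 1
    ext k
    constructor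
    · rintro ⟨w, rfl⟩
      exact ⟨w.map φ.symm.toHom, by simp⟩
    · rintro ⟨w, rfl⟩
      exact ⟨(w.map φ.toHom).copy (by simp) (by simp), by simp⟩
  have h₁ := hmon ((p.map φ.toHom).copy (by simp) (by simp)) (by simp [hp, hd])
  simp only [SimpleGraph.Walk.edges_copy, SimpleGraph.Walk.edges_map, List.mem_map] at h₁
  obtain ⟨e, he, he'⟩ := h₁
  have : e = s(u, v) := Sym2.map.injective φ.injective he'
  exact this ▸ he

end Walks

section Reduction

variable {n : ℕ} (H : SimpleGraph (Fin n)) (t : ℕ)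

/-- The vertices of the graph built from a graph on `n` vertices: copies `(v, i, j)` of each vertex
`v`, row vertices `(v, j)` and hubs `i`, with `i` and `j` below `t`. -/
abbrev GridVertex (n t : ℕ) : Type := (Fin n × Fin t × Fin t) ⊕ (Fin n × Fin t) ⊕ Fin t

/-- The graph of the reduction: `t ^ 2` copies of `H` indexed by pairs `(i, j)`; the copy
`(v, i, j)` is moreover adjacent to the row vertex `(v, j)` and to the hub `i`, and the hubs form
a clique. -/
def gridGraph : SimpleGraph (GridVertex n t) where
  Adj
    | .inl (u, i, j), .inl (v, i', j') => H.Adj u v ∧ i = i' ∧ j = j'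
    | .inl (u, _, j), .inr (.inl (v, j')) => u = v ∧ j = j'
    | .inr (.inl (v, j')), .inl (u, _, j) => u = v ∧ j = j'
    | .inl (_, i, _), .inr (.inr i') => i = i'
    | .inr (.inr i'), .inl (_, i, _) => i = i'
    | .inr (.inr i), .inr (.inr i') => i ≠ i'
    | .inr (.inl _), .inr _ => False
    | .inr (.inr _), .inr (.inl _) => False
  symm := ⟨by
    rintro (⟨u, i, j⟩ | ⟨u, j⟩ | i) (⟨v, i', j'⟩ | ⟨v, j'⟩ | i') h
    · exact ⟨h.1.symm, h.2.1.symm, h.2.2.symm⟩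
    all_goals first | exact h | exact Ne.symm h⟩
  loopless := ⟨by
    rintro (⟨u, i, j⟩ | ⟨u, j⟩ | i) h
    · exact H.loopless.irrefl _ h.1
    · exact h
    · exact h rfl⟩

variable {H t}

theorem gridGraph_adj_copy {u v : Fin n} (h : H.Adj u v) (i j : Fin t) :
    (gridGraph H t).Adj (.inl (u, i, j)) (.inl (v, i, j)) :=
  ⟨h, rfl, rfl⟩

variable (H) in
theorem gridGraph_adj_row (v : Fin n) (i j : Fin t) :
    (gridGraph H t).Adj (.inl (v, i, j)) (.inr (.inl (v, j))) :=
  ⟨rfl, rfl⟩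

variable (H) in
theorem gridGraph_adj_hub (v : Fin n) (i j : Fin t) :
    (gridGraph H t).Adj (.inl (v, i, j)) (.inr (.inr i)) :=
  rfl

theorem gridGraph_connected (ht : 0 < t) : (gridGraph H t).Connected := by
  let z : GridVertex n t := .inr (.inr ⟨0, ht⟩)
  have hhub : ∀ i, (gridGraph H t).Reachable (.inr (.inr i)) z := by
    intro i
    by_cases hi : i = ⟨0, ht⟩
    · subst hi; rfl
    · exact SimpleGraph.Adj.reachable (show (gridGraph H t).Adj _ z from hi)
  have hcopy : ∀ v i j, (gridGraph H t).Reachable (.inl (v, i, j)) z := fun v i j =>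
    (gridGraph_adj_hub H v i j).reachable.trans (hhub i)
  have hall : ∀ x, (gridGraph H t).Reachable x z := by
    rintro (⟨v, i, j⟩ | ⟨v, j⟩ | i)
    · exact hcopy v i j
    · exact (gridGraph_adj_row H v ⟨0, ht⟩ j).symm.reachable.trans (hcopy _ _ _)
    · exact hhub i
  exact { preconnected := fun x y => (hall x).trans (hall y).symm, nonempty := ⟨z⟩ }

/-- Hubs and rows monitor all edges outside the copies of `H`, and a copy of `u` together with a
row of `v` monitors the copies of the edge `uv`. -/
theorem isMEGSet_gridGraph {C : Set (Fin n)} (hC : H.IsVertexCover C) :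
    IsMEGSet (gridGraph H t) {x | Sum.elim (fun p => p.1 ∈ C) (fun _ => True) x} := by
  have hub_row : ∀ v i j,
      Monitors (gridGraph H t) (.inr (.inr i)) (.inr (.inl (v, j))) (.inr (.inr i))
        (.inl (v, i, j)) ∧
      Monitors (gridGraph H t) (.inr (.inr i)) (.inr (.inl (v, j))) (.inl (v, i, j))
        (.inr (.inl (v, j))) := by
    intro v i j
    refine monitors_of_unique (gridGraph_adj_hub H v i j).symm (gridGraph_adj_row H v i j)
      (by simp) (fun h => h) ?_
    rintro (⟨u, i', j'⟩ | ⟨u, j'⟩ | i') h₁ h₂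
    · obtain rfl : i' = i := h₁
      obtain ⟨rfl, rfl⟩ : u = v ∧ j' = j := h₂
      rfl
    · exact h₁.elim
    · exact h₂.elim
  have copy_row : ∀ u v i j, H.Adj u v →
      Monitors (gridGraph H t) (.inl (u, i, j)) (.inr (.inl (v, j))) (.inl (u, i, j))
        (.inl (v, i, j)) := by
    intro u v i j huv
    refine (monitors_of_unique (gridGraph_adj_copy huv i j) (gridGraph_adj_row H v i j) (by simp)
      (fun h => huv.ne h.1) ?_).1
    rintro (⟨w, i', j'⟩ | ⟨w, j'⟩ | i') h₁ h₂
    · obtain ⟨-, rfl, rfl⟩ : _ ∧ i = i' ∧ j = j' := h₁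
      obtain ⟨rfl, -⟩ : w = v ∧ _ := h₂
      rfl
    · exact h₂.elim
    · exact h₂.elim
  have hswap : ∀ {x y u v}, Monitors (gridGraph H t) x y u v → Monitors (gridGraph H t) x y v u :=
    fun h p hp => Sym2.eq_swap ▸ h p hp
  rintro (⟨u, i, j⟩ | ⟨u, j⟩ | i) (⟨v, i', j'⟩ | ⟨v, j'⟩ | i') h
  · obtain ⟨h, rfl, rfl⟩ := h
    rcases hC h with hu | hv
    · exact ⟨.inl (u, i, j), hu, .inr (.inl (v, j)), trivial, copy_row u v i j h⟩
    · exact ⟨.inl (v, i, j), hv, .inr (.inl (u, j)), trivial,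
        hswap (copy_row v u i j h.symm)⟩
  · obtain ⟨rfl, rfl⟩ := h
    refine ⟨_, ?_, _, ?_, (hub_row u i j).2⟩ <;> trivial
  · obtain rfl : i = i' := h
    refine ⟨_, ?_, _, ?_, hswap (hub_row u i j).1⟩ <;> trivial
  · obtain ⟨rfl, rfl⟩ := h
    refine ⟨_, ?_, _, ?_, hswap (hub_row _ i' _).2⟩ <;> trivial
  · exact h.elim
  · exact h.elim
  · obtain rfl := h
    refine ⟨_, ?_, _, ?_, (hub_row v _ j').1⟩ <;> trivial
  · exact h.elim
  · refine ⟨_, ?_, _, ?_, monitors_of_adj h⟩ <;> trivial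

/-- A path `a, u, v, b` around an edge of a copy of `H` can be rerouted through the hub of the
copy, or, if `a` and `b` are rows, through a copy with the same rows. -/
theorem exists_walk_avoiding (ht : 2 ≤ t) {u v : Fin n} (huv : H.Adj u v) (i j : Fin t)
    (a b : GridVertex n t) (ha : (gridGraph H t).Adj a (.inl (u, i, j)))
    (hb : (gridGraph H t).Adj (.inl (v, i, j)) b) (hav : a ≠ .inl (v, i, j))
    (hbu : b ≠ .inl (u, i, j)) :
    ∃ q : (gridGraph H t).Walk a b, q.length ≤ 3 ∧
      s((.inl (u, i, j) : GridVertex n t), .inl (v, i, j)) ∉ q.edges := by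
  have hhubu : (gridGraph H t).Adj (.inl (u, i, j)) (.inr (.inr i)) := rfl
  have hhubv : (gridGraph H t).Adj (.inr (.inr i)) (.inl (v, i, j)) := rfl
  have hne : u ≠ v := huv.ne
  rcases a with ⟨x, i₁, j₁⟩ | ⟨x, j₁⟩ | i₁
  · obtain ⟨hx, rfl, rfl⟩ : H.Adj x u ∧ i₁ = i ∧ j₁ = j := ha
    have hxv : x ≠ v := fun h => hav (by rw [h])
    have h₁ : (gridGraph H t).Adj (.inl (x, i₁, j₁)) (.inr (.inr i₁)) := rfl
    refine ⟨.cons h₁ (.cons hhubv (.cons hb .nil)), by simp, ?_⟩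
    simp [hne, Ne.symm hbu]
  · obtain ⟨rfl, rfl⟩ : u = x ∧ j = j₁ := ha
    have ha' := (gridGraph_adj_row H u i j).symm
    rcases b with ⟨y, i₂, j₂⟩ | ⟨y, j₂⟩ | i₂
    · obtain ⟨-, rfl, rfl⟩ : H.Adj v y ∧ i = i₂ ∧ j = j₂ := hb
      exact ⟨.cons ha' (.cons hhubu (.cons (gridGraph_adj_hub H y i j).symm .nil)), by simp,
        by simp⟩
    · obtain ⟨rfl, rfl⟩ : v = y ∧ j = j₂ := hb
      obtain ⟨i', hi'⟩ : ∃ i', i' ≠ i :=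
        haveI : Nontrivial (Fin t) := Fin.nontrivial_iff_two_le.2 ht
        exists_ne i
      refine ⟨.cons (gridGraph_adj_row H u i' j).symm (.cons (gridGraph_adj_copy huv i' j)
        (.cons (gridGraph_adj_row H v i' j) .nil)), by simp, ?_⟩
      simp [hi'.symm]
    · obtain rfl : i = i₂ := hb
      exact ⟨.cons ha' (.cons hhubu .nil), by simp, by simp⟩
  · obtain rfl : i = i₁ := ha
    refine ⟨.cons hhubv (.cons hb .nil), by simp, ?_⟩
    simp [hne, Ne.symm hbu]

/-- The trace of a MEG-set on each copy of `H` is a vertex cover of `H`. -/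
theorem isVertexCover_of_isMEGSet (ht : 2 ≤ t) {M : Set (GridVertex n t)}
    (hM : IsMEGSet (gridGraph H t) M) (i j : Fin t) :
    H.IsVertexCover {v | (.inl (v, i, j) : GridVertex n t) ∈ M} := by
  intro u v huv
  exact mem_of_monitors (gridGraph_connected (by omega))
    (gridGraph_adj_copy huv i j)
    (exists_walk_avoiding ht huv i j) (exists_walk_avoiding ht huv.symm i j) hM

end Reduction

end MEG

/-! ### Encodings of graphs and vertex sets -/

namespace MEG

open Turing

theorem mul_add_lt {a b m n : ℕ} (ha : a < n) (hb : b < m) : a * m + b < n * m := by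
  have := Nat.mul_le_mul_right m (Nat.succ_le_of_lt ha)
  rw [Nat.succ_mul] at this
  omega

theorem mul_add_div_eq {a b m : ℕ} (hb : b < m) : (a * m + b) / m = a := by
  rw [mul_comm, Nat.mul_add_div (by omega), Nat.div_eq_of_lt hb, add_zero]

theorem mul_add_mod_eq {a b m : ℕ} (hb : b < m) : (a * m + b) % m = b := by
  rw [mul_comm, Nat.mul_add_mod, Nat.mod_eq_of_lt hb]

theorem flatMap_finRange (N : ℕ) (F : ℕ → ℕ → Bool) :
    ((List.finRange N).flatMap fun i : Fin N => (List.finRange N).map fun j : Fin N =>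
      F (i : ℕ) (j : ℕ)) =
      (List.range (N * N)).map fun m => F (m / N) (m % N) := by
  have h := List.ofFn_mul (fun k : Fin (N * N) => F (k / N) (k % N))
  have e : (List.range (N * N)).map (fun m => F (m / N) (m % N)) =
      List.ofFn fun k : Fin (N * N) => F (k / N) (k % N) := by
    rw [List.ofFn_eq_map, ← List.map_coe_finRange_eq_range, List.map_map]
    rfl
  rw [e, h, List.flatMap_def, List.ofFn_eq_map]
  congr 1
  refine List.map_congr_left fun i _ => ?_
  rw [List.ofFn_eq_map]
  refine List.map_congr_left fun j _ => ?_
  dsimp only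
  rw [mul_add_div_eq j.2, mul_add_mod_eq j.2]

/-- The bit at position `k` of the encoding of a graph on `N` vertices with adjacency `adj`: the
order in unary takes the positions below `N`, the closing `false` position `N`. -/
def EncodeBit (N : ℕ) (adj : ℕ → ℕ → Prop) (k : ℕ) : Prop :=
  k < N ∨ (N + 1 ≤ k ∧ adj ((k - (N + 1)) / N) ((k - (N + 1)) % N))

open Classical in
theorem encodeGraph_eq (G : FiniteGraph) (adj : ℕ → ℕ → Prop)
    (hadj : ∀ i j : Fin G.order, adj i j ↔ G.graph.Adj i j) :
    encodeGraph G = (List.range (G.order + 1 + G.order * G.order)).map fun k =>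
      decide (EncodeBit G.order adj k) := by
  have h := flatMap_finRange G.order fun i j => decide (adj i j)
  simp only [hadj] at h
  unfold encodeGraph
  rw [h, List.range_add, List.range_succ, List.map_append, List.map_append, List.append_assoc,
    List.map_map]
  congr 1
  · refine (List.eq_replicate_iff.2 ⟨by simp, fun b hb => ?_⟩).symm
    obtain ⟨k, hk, rfl⟩ := List.mem_map.1 hb
    rw [List.mem_range] at hk
    simp [EncodeBit, hk]
  · simp only [List.map_cons, List.map_nil, List.singleton_append]
    congr 1
    · simp [EncodeBit]
    · refine List.map_congr_left fun k _ => ?_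
      have h₁ : ¬ (G.order + 1 + k < G.order) := by omega
      have h₂ : G.order < G.order + 1 + k := by omega
      simp [EncodeBit, h₁, h₂]

theorem length_encodeGraph (G : FiniteGraph) :
    (encodeGraph G).length = G.order + 1 + G.order * G.order := by
  rw [encodeGraph_eq G (fun i j => ∃ hi hj, G.graph.Adj ⟨i, hi⟩ ⟨j, hj⟩)
    (fun i j => by simp)]
  simp

theorem getElem?_encodeGraph (G : FiniteGraph) (i j : Fin G.order) :
    (encodeGraph G)[G.order + 1 + (i * G.order + j)]? = some true ↔ G.graph.Adj i j := by
  rw [encodeGraph_eq G (fun i j => ∃ hi hj, G.graph.Adj ⟨i, hi⟩ ⟨j, hj⟩)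
    (fun i j => by simp)]
  classical
  have hlt := mul_add_lt i.2 j.2
  have h₁ : ¬ (G.order + 1 + (i * G.order + j) < G.order) := by omega
  rw [List.getElem?_map, List.getElem?_range (by omega), Option.map_some, Option.some.injEq,
    decide_eq_true_eq, EncodeBit, Nat.add_sub_cancel_left, mul_add_div_eq j.2, mul_add_mod_eq j.2]
  simp [h₁]

theorem bitAt_encodeVertexSet {n : ℕ} (S : Finset (Fin n)) (k : Fin n) :
    bitAt (encodeVertexSet S) k = if k ∈ S then 1 else 0 := by
  have h : (encodeVertexSet S)[(k : ℕ)]? = some (decide (k ∈ S)) := by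
    simp [encodeVertexSet]
  rw [bitAt, h]
  by_cases hk : k ∈ S <;> simp [hk]

theorem sum_bitAt_encodeVertexSet {n : ℕ} (S : Finset (Fin n)) :
    ∑ k ∈ Finset.range n, bitAt (encodeVertexSet S) k = S.card := by
  rw [Finset.sum_range]
  simp only [bitAt_encodeVertexSet]
  simp

/-! ### Numbering the vertices of the grid graph -/

/-- The numbering of the vertices of `gridGraph H t`: copies, then rows, then hubs. -/
def gridEquiv (n t : ℕ) : GridVertex n t ≃ Fin (n * (t * t) + (n * t + t)) :=
  (Equiv.sumCongr (((Equiv.refl _).prodCongr finProdFinEquiv).trans finProdFinEquiv)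
    ((finProdFinEquiv.sumCongr (Equiv.refl _)).trans finSumFinEquiv)).trans finSumFinEquiv

section Code

variable {n t : ℕ}

theorem gridEquiv_copy (v : Fin n) (i j : Fin t) :
    (gridEquiv n t (.inl (v, i, j)) : ℕ) = v * (t * t) + (i * t + j) := by
  simp [gridEquiv]; ring

theorem gridEquiv_row (v : Fin n) (j : Fin t) :
    (gridEquiv n t (.inr (.inl (v, j))) : ℕ) = n * (t * t) + (v * t + j) := by
  simp [gridEquiv]; ring

theorem gridEquiv_hub (i : Fin t) :
    (gridEquiv n t (.inr (.inr i)) : ℕ) = n * (t * t) + (n * t + i) := by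
  simp [gridEquiv]

/-- Adjacency in `gridGraph`, up to symmetry, in terms of the numbers of the vertices, where `h` is
adjacency in the original graph. The alternatives are the edges inside a copy, from copies to rows,
from copies to hubs, and between hubs. -/
def GridCode (n t : ℕ) (h : ℕ → ℕ → Prop) (k l : ℕ) : Prop :=
  (k < n * (t * t) ∧ l < n * (t * t) ∧ h (k / (t * t)) (l / (t * t)) ∧
    k % (t * t) = l % (t * t)) ∨
  (k < n * (t * t) ∧ n * (t * t) ≤ l ∧ l < n * (t * t) + n * t ∧
    k / (t * t) = (l - n * (t * t)) / t ∧ k % t = (l - n * (t * t)) % t) ∨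
  (k < n * (t * t) ∧ n * (t * t) + n * t ≤ l ∧ k / t % t = l - (n * (t * t) + n * t)) ∨
  (n * (t * t) + n * t ≤ k ∧ n * (t * t) + n * t ≤ l ∧ ¬ k = l)

theorem gridGraph_adj_iff (H : SimpleGraph (Fin n)) (h : ℕ → ℕ → Prop)
    (hh : ∀ u v : Fin n, h u v ↔ H.Adj u v) (x y : GridVertex n t) :
    (gridGraph H t).Adj x y ↔ GridCode n t h (gridEquiv n t x) (gridEquiv n t y) ∨
      GridCode n t h (gridEquiv n t y) (gridEquiv n t x) := by
  have ij_lt : ∀ i j : Fin t, (i : ℕ) * t + j < t * t := fun i j => mul_add_lt i.2 j.2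
  have row_lt : ∀ (v : Fin n) (j : Fin t), (v : ℕ) * t + j < n * t := fun v j => mul_add_lt v.2 j.2
  have copy_lt : ∀ (v : Fin n) (i j : Fin t), (v : ℕ) * (t * t) + (i * t + j) < n * (t * t) :=
    fun v i j => mul_add_lt v.2 (ij_lt i j)
  have div₁ : ∀ (v : Fin n) (i j : Fin t), ((v : ℕ) * (t * t) + (i * t + j)) / (t * t) = v :=
    fun v i j => mul_add_div_eq (ij_lt i j)
  have mod₁ : ∀ (v : Fin n) (i j : Fin t),
      ((v : ℕ) * (t * t) + (i * t + j)) % (t * t) = i * t + j :=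
    fun v i j => mul_add_mod_eq (ij_lt i j)
  have e : ∀ (v : Fin n) (i j : Fin t), (v : ℕ) * (t * t) + (i * t + j) = (v * t + i) * t + j :=
    fun v i j => by ring
  have mod₂ : ∀ (v : Fin n) (i j : Fin t), ((v : ℕ) * (t * t) + (i * t + j)) % t = j :=
    fun v i j => by rw [e, mul_add_mod_eq j.2]
  have div₂ : ∀ (v : Fin n) (i j : Fin t), ((v : ℕ) * (t * t) + (i * t + j)) / t % t = i :=
    fun v i j => by rw [e, mul_add_div_eq j.2, mul_add_mod_eq i.2]
  have div₃ : ∀ (v : Fin n) (j : Fin t), ((v : ℕ) * t + j) / t = v := fun v j => mul_add_div_eq j.2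
  have mod₃ : ∀ (v : Fin n) (j : Fin t), ((v : ℕ) * t + j) % t = j := fun v j => mul_add_mod_eq j.2
  have inj : ∀ i j i' j' : Fin t, (i : ℕ) * t + j = i' * t + j' ↔ i = i' ∧ j = j' := by
    intro i j i' j'
    refine ⟨fun h => ⟨Fin.ext ?_, Fin.ext ?_⟩, fun h => by rw [h.1, h.2]⟩
    · rw [← mul_add_div_eq (a := i) j.2, h, mul_add_div_eq j'.2]
    · rw [← mul_add_mod_eq (a := i) j.2, h, mul_add_mod_eq j'.2]
  have row_not_copy : ∀ (v : Fin n) (j : Fin t), ¬ n * (t * t) + (v * t + j) < n * (t * t) :=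
    fun v j => by omega
  have hub_not_copy : ∀ i : Fin t, ¬ n * (t * t) + (n * t + i) < n * (t * t) := fun i => by omega
  have hub_not_row : ∀ i : Fin t, ¬ n * (t * t) + (n * t + i) < n * (t * t) + n * t :=
    fun i => by omega
  have copy_not_row : ∀ (v : Fin n) (i j : Fin t),
      ¬ n * (t * t) ≤ (v : ℕ) * (t * t) + (i * t + j) := fun v i j => not_le.2 (copy_lt v i j)
  have copy_not_hub : ∀ (v : Fin n) (i j : Fin t),
      ¬ n * (t * t) + n * t ≤ (v : ℕ) * (t * t) + (i * t + j) :=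
    fun v i j => by have := copy_lt v i j; omega
  have row_not_hub : ∀ (v : Fin n) (j : Fin t),
      ¬ n * (t * t) + n * t ≤ n * (t * t) + (v * t + j) := fun v j => by have := row_lt v j; omega
  have row_lt' : ∀ (v : Fin n) (j : Fin t),
      n * (t * t) + (v * t + j) < n * (t * t) + n * t := fun v j => by have := row_lt v j; omega
  have hub_le : ∀ i : Fin t, n * (t * t) + n * t ≤ n * (t * t) + (n * t + i) := fun i => by omega
  have hub_sub : ∀ i : Fin t, n * (t * t) + (n * t + i) - (n * (t * t) + n * t) = i :=
    fun i => by omega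
  rcases x with ⟨u, i, j⟩ | ⟨u, j⟩ | i <;> rcases y with ⟨v, i', j'⟩ | ⟨v, j'⟩ | i' <;>
    simp only [gridEquiv_copy, gridEquiv_row, gridEquiv_hub, GridCode, copy_lt, row_not_copy,
      hub_not_copy, hub_not_row, copy_not_row, copy_not_hub, row_not_hub, row_lt', hub_le, hub_sub,
      div₁, mod₁, mod₂, div₂, Nat.add_sub_cancel_left, div₃, mod₃, inj, hh, true_and, false_and,
      and_false, or_false, false_or, Nat.le_add_right, add_right_inj, Fin.val_inj]
  · exact ⟨fun h => .inl h, fun h => h.elim id fun h => ⟨h.1.symm, h.2.1.symm, h.2.2.symm⟩⟩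
  · exact Iff.rfl
  · exact Iff.rfl
  · exact Iff.rfl
  · exact Iff.rfl
  · exact Iff.rfl
  · exact Iff.rfl
  · exact Iff.rfl
  · exact ⟨fun h => .inl h, fun h => h.elim id Ne.symm⟩

end Code

end MEG

/-! ### Computing the reduction -/

namespace Turing

/-- The argument of a strictly increasing function is the number of `x` with `F (x + 1)` at most
its value. This recovers the order of a graph from the length of an encoding. -/
theorem Arith.inverse {α : Type} {inp : α → List Bool} {vs : List (α → ℕ)} {n : α → ℕ} {F : ℕ → ℕ}
    (hF : StrictMono F) (h : Arith inp vs fun a => F (n a))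
    (h' : Arith (fun p : α × ℕ => inp p.1) (Prod.snd :: vs.map fun g p => g p.1)
      (fun p => F (p.2 + 1))) : Arith inp vs n := by
  classical
  refine (h.sum (f := fun a x => if F (x + 1) ≤ F (n a) then 1 else 0)
    (Arith.congr (ArithPred.le h' h.weaken) fun _ => by congr)).congr fun a => ?_
  have e : (Finset.range (F (n a))).filter (fun x => F (x + 1) ≤ F (n a)) =
      Finset.range (n a) := by
    ext x
    rw [Finset.mem_filter, Finset.mem_range, Finset.mem_range, hF.le_iff_le]
    have := hF.le_apply (x := n a)
    omega
  rw [Finset.sum_boole, e, Finset.card_range, Nat.cast_id]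

/-- Restricting a computation to some of its inputs. -/
def TM2ComputableInPolyTime.restrict {α β Γ₀ Γ₁ : Type} {ea : α → List Γ₀} {f : α → List Γ₁}
    (h : TM2ComputableInPolyTime ea (id : List Γ₁ → List Γ₁) f) (φ : β → α) :
    TM2ComputableInPolyTime (fun b => ea (φ b)) (id : List Γ₁ → List Γ₁) (fun b => f (φ b)) where
  toTM2ComputableAux := h.toTM2ComputableAux
  time := h.time
  outputsFun b := h.outputsFun (φ b)

end Turing

namespace MEG

open Turing

/-- The order of the graph built from a graph on `n` vertices with side `t`. -/
def gridOrder (n t : ℕ) : ℕ := n * (t * t) + (n * t + t)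

/-- The graph of the reduction, with side `C * (n + 1)` for a graph on `n` vertices and with its
vertices numbered. -/
def gridReduction (C : ℕ) (G : FiniteGraph) : FiniteGraph where
  order := gridOrder G.order (C * (G.order + 1))
  graph := (gridGraph G.graph (C * (G.order + 1))).comap
    (gridEquiv G.order (C * (G.order + 1))).symm

/-- The graph of the reduction before numbering its vertices. -/
def gridIso (C : ℕ) (G : FiniteGraph) :
    (gridReduction C G).graph ≃g gridGraph G.graph (C * (G.order + 1)) :=
  SimpleGraph.Iso.comap (gridEquiv G.order (C * (G.order + 1))).symm _

section Computing

variable {α : Type} {inp : α → List Bool} {vs : List (α → ℕ)}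

theorem arith_gridOrder {n t : α → ℕ} (hn : Arith inp vs n) (ht : Arith inp vs t) :
    Arith inp vs fun a => gridOrder (n a) (t a) :=
  (hn.mul (ht.mul ht)).add ((hn.mul ht).add ht)

theorem arithPred_gridCode {n t k l : α → ℕ} {h : α → ℕ → ℕ → Prop} (hn : Arith inp vs n)
    (ht : Arith inp vs t) (hk : Arith inp vs k) (hl : Arith inp vs l) (hpos : ∀ a, 0 < t a)
    (hh : ArithPred inp vs fun a => h a (k a / (t a * t a)) (l a / (t a * t a))) :
    ArithPred inp vs fun a => GridCode (n a) (t a) (h a) (k a) (l a) := by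
  have htt := ht.mul ht
  have hpos' : ∀ a, 0 < t a * t a := fun a => Nat.mul_pos (hpos a) (hpos a)
  have hm := hn.mul htt
  have hr := hm.add (hn.mul ht)
  have hlm := hl.sub hm
  refine .or (.and (.lt hk hm) (.and (.lt hl hm) (.and hh
    (.eq (hk.mod htt hpos') (hl.mod htt hpos'))))) (.or ?_ (.or ?_ ?_))
  · exact .and (.lt hk hm) (.and (.le hm hl) (.and (.lt hl hr) (.and
      (.eq (hk.div htt hpos') (hlm.div ht hpos)) (.eq (hk.mod ht hpos) (hlm.mod ht hpos)))))
  · exact .and (.lt hk hm) (.and (.le hr hl) (.eq ((hk.div ht hpos).mod ht hpos) (hl.sub hr)))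
  · exact .and (.le hr hk) (.and (.le hr hl) (.not (.eq hk hl)))

theorem arithPred_encodeBit {N k : α → ℕ} {adj : α → ℕ → ℕ → Prop} (hN : Arith inp vs N)
    (hk : Arith inp vs k)
    (hadj : ArithPred inp vs fun a =>
      adj a ((k a - (N a + 1)) / N a) ((k a - (N a + 1)) % N a)) :
    ArithPred inp vs fun a => EncodeBit (N a) (adj a) (k a) :=
  .or (.lt hk hN) (.and (.le (hN.add .one) hk) hadj)

theorem arith_order : Arith encodeGraph [] FiniteGraph.order := by
  refine Arith.inverse (F := fun n => n + 1 + n * n) ?_ ?_ ?_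
  · intro a b h
    have := Nat.mul_self_le_mul_self h.le
    dsimp only
    omega
  · exact Arith.length.congr length_encodeGraph
  · have h : Arith (fun p : FiniteGraph × ℕ => encodeGraph p.1) [Prod.snd] fun p => p.2 + 1 :=
      .add (.head _ _) .one
    exact (h.add .one).add (h.mul h)

theorem nonempty_polyTime_gridReduction {C : ℕ} (hC : 0 < C) :
    Nonempty (TM2ComputableInPolyTime encodeGraph (id : List Bool → List Bool)
      fun G => encodeGraph (gridReduction C G)) := by
  classical
  let h : FiniteGraph → ℕ → ℕ → Prop := fun G u v =>
    (encodeGraph G)[G.order + 1 + (u * G.order + v)]? = some true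
  let adj : FiniteGraph → ℕ → ℕ → Prop := fun G k l =>
    GridCode G.order (C * (G.order + 1)) (h G) k l ∨ GridCode G.order (C * (G.order + 1)) (h G) l k
  have hadj : ∀ (G : FiniteGraph)
      (i j : Fin (G.order * (C * (G.order + 1) * (C * (G.order + 1))) +
        (G.order * (C * (G.order + 1)) + C * (G.order + 1)))),
      adj G i j ↔ ((gridGraph G.graph (C * (G.order + 1))).comap (gridEquiv _ _).symm).Adj i j := by
    intro G i j
    have := gridGraph_adj_iff (t := C * (G.order + 1)) G.graph (h G) (getElem?_encodeGraph G)
      ((gridEquiv _ _).symm i) ((gridEquiv _ _).symm j)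
    rw [Equiv.apply_symm_apply, Equiv.apply_symm_apply] at this
    exact this.symm
  have hn := arith_order
  have ht := (Arith.const C).mul (hn.add .one)
  have hN := arith_gridOrder hn ht
  have hpos : ∀ G : FiniteGraph, 0 < C * (G.order + 1) := fun G => by positivity
  have hNpos : ∀ G : FiniteGraph, 0 < gridOrder G.order (C * (G.order + 1)) := fun G => by
    have := hpos G
    unfold gridOrder
    omega
  have hk : Arith (fun p : FiniteGraph × ℕ => encodeGraph p.1) [Prod.snd] Prod.snd := .head _ _
  have hlen : Arith encodeGraph [] fun G => gridOrder G.order (C * (G.order + 1)) + 1 +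
      gridOrder G.order (C * (G.order + 1)) * gridOrder G.order (C * (G.order + 1)) :=
    (hN.add .one).add (hN.mul hN)
  have hn' : Arith (fun p : FiniteGraph × ℕ => encodeGraph p.1) [Prod.snd]
    (fun p => p.1.order) := hn.weaken
  have ht' : Arith (fun p : FiniteGraph × ℕ => encodeGraph p.1) [Prod.snd]
    (fun p => C * (p.1.order + 1)) := ht.weaken
  have hN' : Arith (fun p : FiniteGraph × ℕ => encodeGraph p.1) [Prod.snd]
    (fun p => gridOrder p.1.order (C * (p.1.order + 1))) := hN.weaken
  have hcode : ∀ {k l : FiniteGraph × ℕ → ℕ},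
      Arith (fun p : FiniteGraph × ℕ => encodeGraph p.1) [Prod.snd] k →
      Arith (fun p : FiniteGraph × ℕ => encodeGraph p.1) [Prod.snd] l →
      ArithPred (fun p : FiniteGraph × ℕ => encodeGraph p.1) [Prod.snd] fun p =>
        GridCode p.1.order (C * (p.1.order + 1)) (h p.1) (k p) (l p) := by
    intro k l hk hl
    have hpos' : ∀ p : FiniteGraph × ℕ, 0 < C * (p.1.order + 1) * (C * (p.1.order + 1)) :=
      fun p => Nat.mul_pos (hpos p.1) (hpos p.1)
    refine arithPred_gridCode (h := fun p => h p.1) hn' ht' hk hl (fun p => hpos p.1) ?_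
    exact .bit ((hn'.add .one).add (((hk.div (ht'.mul ht') hpos').mul hn').add
      (hl.div (ht'.mul ht') hpos')))
  have hr := (hk.sub (hN'.add .one)).div hN' fun p => hNpos p.1
  have hc := (hk.sub (hN'.add .one)).mod hN' fun p => hNpos p.1
  have hbit := arithPred_encodeBit (adj := fun p => adj p.1) hN' hk
    (.or (hcode hr hc) (hcode hc hr))
  refine Arith.nonempty_polyTime hlen (g := fun G k =>
    if EncodeBit (gridOrder G.order (C * (G.order + 1))) (adj G) k then 1 else 0)
    (Arith.congr hbit fun _ => by congr) fun G => ?_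
  rw [encodeGraph_eq (gridReduction C G) (adj G) (hadj G)]
  refine List.map_congr_left fun k _ => decide_eq_decide.2 ?_
  change EncodeBit (gridOrder G.order (C * (G.order + 1))) (adj G) k ↔ _
  split_ifs with hk <;> simp [hk]

end Computing

/-! ### The cover read off from the best copy -/

section Choice

/-- The number of vertices of the copy with index `c` of a graph on `n` vertices in a set of
vertices of the graph of the reduction given by its characteristic vector `w`. -/
def copyCard (w : List Bool) (n t c : ℕ) : ℕ :=
  ∑ v ∈ Finset.range n, bitAt w (v * (t * t) + c)

/-- The first copy containing at most the average number of vertices per copy. -/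
noncomputable def bestCopy (w : List Bool) (n t : ℕ) : ℕ :=
  leastBelow (t * t) fun c => t * t * copyCard w n t c ≤ ∑ k ∈ Finset.range w.length, bitAt w k

theorem sum_copyCard (w : List Bool) (n t : ℕ) :
    ∑ c ∈ Finset.range (t * t), copyCard w n t c =
      ∑ k ∈ Finset.range (n * (t * t)), bitAt w k := by
  unfold copyCard
  rw [Finset.sum_comm]
  induction n with
  | zero => simp
  | succ n ih => rw [Finset.sum_range_succ, ih, Nat.succ_mul, Finset.sum_range_add]

theorem bestCopy_spec {w : List Bool} {n t : ℕ} (ht : 0 < t) (hw : w.length = gridOrder n t) :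
    bestCopy w n t < t * t ∧ t * t * copyCard w n t (bestCopy w n t) ≤
      ∑ k ∈ Finset.range w.length, bitAt w k := by
  refine leastBelow_spec ?_
  by_contra! h
  have h₁ : ∑ c ∈ Finset.range (t * t), ∑ k ∈ Finset.range w.length, bitAt w k <
      ∑ c ∈ Finset.range (t * t), t * t * copyCard w n t c :=
    Finset.sum_lt_sum_of_nonempty ⟨0, Finset.mem_range.2 (Nat.mul_pos ht ht)⟩
      fun c hc => h c (Finset.mem_range.1 hc)
  rw [Finset.sum_const, Finset.card_range, smul_eq_mul, ← Finset.mul_sum, sum_copyCard] at h₁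
  refine absurd h₁ (not_lt.2 (Nat.mul_le_mul_left _ ?_))
  refine Finset.sum_le_sum_of_subset (Finset.range_subset_range.2 ?_)
  rw [hw, gridOrder]
  omega

/-- The vertices whose copy in the best block belongs to the set with characteristic vector `w`. -/
noncomputable def coverOf (w : List Bool) (n t : ℕ) : Finset (Fin n) :=
  Finset.univ.filter fun v : Fin n => bitAt w (v * (t * t) + bestCopy w n t) ≠ 0

theorem card_coverOf (w : List Bool) (n t : ℕ) :
    (coverOf w n t).card = copyCard w n t (bestCopy w n t) := by
  rw [coverOf, copyCard, Finset.sum_range, Finset.card_filter]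
  refine Finset.sum_congr rfl fun v _ => ?_
  unfold bitAt
  cases w[(v : ℕ) * (t * t) + bestCopy w n t]?.getD false <;> simp

/-- The cover is computable from the MEG-set alone: the order of the original graph is recovered
from the number of vertices of the graph of the reduction. -/
theorem nonempty_polyTime_coverOf {α : Type} {C : ℕ} (hC : 0 < C) (w : α → List Bool) (n : α → ℕ)
    (hw : ∀ a, (w a).length = gridOrder (n a) (C * (n a + 1))) :
    Nonempty (TM2ComputableInPolyTime w (id : List Bool → List Bool)
      fun a => encodeVertexSet (coverOf (w a) (n a) (C * (n a + 1)))) := by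
  classical
  have hn : Arith w [] n := by
    refine Arith.inverse (F := fun n => gridOrder n (C * (n + 1))) ?_ ?_ ?_
    · intro a b h
      have h₁ : C * (a + 1) ≤ C * (b + 1) := Nat.mul_le_mul_left _ (by omega)
      have h₂ : C * (a + 1) < C * (b + 1) := Nat.mul_lt_mul_of_pos_left (by omega) hC
      have h₃ := Nat.mul_le_mul h.le (Nat.mul_le_mul h₁ h₁)
      have h₄ := Nat.mul_le_mul h.le h₁
      dsimp only [gridOrder]
      omega
    · exact Arith.length.congr hw
    · have h : Arith (fun p : α × ℕ => w p.1) [Prod.snd] fun p => p.2 + 1 :=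
        .add (.head _ _) .one
      exact arith_gridOrder h ((Arith.const C).mul (h.add .one))
  have ht := (Arith.const C).mul (hn.add .one)
  have htt := ht.mul ht
  have hn' : Arith (fun p : α × ℕ => w p.1) [Prod.snd] fun p => n p.1 := hn.weaken
  have htt' : Arith (fun p : α × ℕ => w p.1) [Prod.snd]
    fun p => C * (n p.1 + 1) * (C * (n p.1 + 1)) := htt.weaken
  have hcard : Arith (fun p : α × ℕ => w p.1) [Prod.snd]
      fun p => copyCard (w p.1) (n p.1) (C * (n p.1 + 1)) p.2 := by
    refine hn'.sum (f := fun p v => bitAt (w p.1) (v * (C * (n p.1 + 1) * (C * (n p.1 + 1))) + p.2))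
      ?_
    have hc : Arith (fun q : (α × ℕ) × ℕ => w q.1.1)
        (Prod.snd :: ([Prod.snd] : List (α × ℕ → ℕ)).map fun g q => g q.1) fun q => q.1.2 :=
      Arith.weaken (inp := fun p : α × ℕ => w p.1) (f := Prod.snd) (.head _ _)
    have hv : Arith (fun q : (α × ℕ) × ℕ => w q.1.1)
        (Prod.snd :: ([Prod.snd] : List (α × ℕ → ℕ)).map fun g q => g q.1)
        fun q => C * (n q.1.1 + 1) * (C * (n q.1.1 + 1)) :=
      Arith.weaken (inp := fun p : α × ℕ => w p.1) htt'
    have hs : Arith (fun q : (α × ℕ) × ℕ => w q.1.1)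
        (Prod.snd :: ([Prod.snd] : List (α × ℕ → ℕ)).map fun g q => g q.1) Prod.snd :=
      .head _ _
    exact .bit ((hs.mul hv).add hc)
  have htotal : Arith w [] fun a => ∑ k ∈ Finset.range (w a).length, bitAt (w a) k :=
    Arith.length.sum (f := fun a k => bitAt (w a) k) (.bit .snd)
  have hbest : Arith w [] fun a => bestCopy (w a) (n a) (C * (n a + 1)) :=
    htt.least (p := fun a c => C * (n a + 1) * (C * (n a + 1)) *
      copyCard (w a) (n a) (C * (n a + 1)) c ≤ ∑ k ∈ Finset.range (w a).length, bitAt (w a) k)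
      (.le (htt'.mul hcard) htotal.weaken)
  refine Arith.nonempty_polyTime hn (g := fun a v => bitAt (w a)
    (v * (C * (n a + 1) * (C * (n a + 1))) + bestCopy (w a) (n a) (C * (n a + 1))))
    (.bit ((Arith.snd.mul htt').add hbest.weaken)) fun a => ?_
  rw [← List.map_coe_finRange_eq_range, List.map_map, encodeVertexSet]
  refine List.map_congr_left fun v _ => ?_
  simp [coverOf]

end Choice

/-! ### The approximation ratio -/

section Approximation

variable {C : ℕ}

theorem gridReduction_connected (hC : 0 < C) (G : FiniteGraph) :
    (gridReduction C G).graph.Connected :=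
  (gridIso C G).connected_iff.2 (gridGraph_connected (by positivity))

/-- A minimum vertex cover in each copy, together with all rows and hubs, is a MEG-set. -/
theorem opt_gridReduction_le (G : FiniteGraph) :
    megSetProblem.opt (gridReduction C G) ≤
      vertexCoverProblem.opt G * (C * (G.order + 1) * (C * (G.order + 1))) +
        (G.order * (C * (G.order + 1)) + C * (G.order + 1)) := by
  set t := C * (G.order + 1) with ht
  obtain ⟨S, hS, hcard⟩ : ∃ S : Finset (Fin G.order), vertexCoverProblem.IsFeasible G S ∧
      S.card = vertexCoverProblem.opt G :=
    Nat.sInf_mem (s := {k : ℕ | ∃ S : Finset (Fin G.order), vertexCoverProblem.IsFeasible G S ∧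
      S.card = k}) ⟨_, Finset.univ, by
        change G.graph.IsVertexCover ((Finset.univ : Finset (Fin G.order)) : Set (Fin G.order))
        rw [Finset.coe_univ]
        exact SimpleGraph.isVertexCover_univ, rfl⟩
  let M : Finset (GridVertex G.order t) :=
    (S ×ˢ (Finset.univ : Finset (Fin t × Fin t))).disjSum Finset.univ
  refine Nat.sInf_le ⟨M.map (gridIso C G).symm.toEquiv.toEmbedding, ?_, ?_⟩
  · have h := (isMEGSet_gridGraph (t := t) hS).of_iso (gridIso C G)
    have e : ((M.map (gridIso C G).symm.toEquiv.toEmbedding : Finset _) :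
        Set (Fin (gridReduction C G).order)) = gridIso C G ⁻¹'
          {x | Sum.elim (fun p => p.1 ∈ (S : Set (Fin G.order))) (fun _ => True) x} := by
      ext x
      rw [Finset.mem_coe, Finset.mem_map_equiv]
      change gridIso C G x ∈ M ↔ Sum.elim (fun p => p.1 ∈ (S : Set (Fin G.order)))
        (fun _ => True) (gridIso C G x)
      rcases gridIso C G x with ⟨v, i, j⟩ | y <;> simp [M]
    rw [← e] at h
    exact h
  · rw [Finset.card_map, Finset.card_disjSum, Finset.card_product, hcard]
    simp

theorem isVertexCover_coverOf (hC : 2 ≤ C) (G : FiniteGraph)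
    {M : Finset (Fin (gridReduction C G).order)}
    (hM : IsMEGSet (gridReduction C G).graph (M : Set (Fin (gridReduction C G).order))) :
    G.graph.IsVertexCover
      (coverOf (encodeVertexSet M) G.order (C * (G.order + 1)) : Set (Fin G.order)) := by
  have ht : 2 ≤ C * (G.order + 1) := by nlinarith
  set t := C * (G.order + 1) with ht'
  obtain ⟨hc, -⟩ := bestCopy_spec (w := encodeVertexSet M) (n := G.order) (t := t) (by omega)
    (by simp [encodeVertexSet, gridReduction, ht'])
  set c := bestCopy (encodeVertexSet M) G.order t
  let i : Fin t := ⟨c / t, Nat.div_lt_of_lt_mul hc⟩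
  let j : Fin t := ⟨c % t, Nat.mod_lt _ (by omega)⟩
  have h := isVertexCover_of_isMEGSet ht (hM.of_iso (gridIso C G).symm) i j
  refine h.subset fun v hv => ?_
  have e : (((gridIso C G).symm (.inl (v, i, j)) : Fin (gridReduction C G).order) : ℕ) =
      v * (t * t) + c := by
    refine (gridEquiv_copy v i j).trans ?_
    rw [show (i : ℕ) * t + j = c from Nat.div_add_mod' c t]
  have hv' : (gridIso C G).symm (.inl (v, i, j)) ∈ M := hv
  simp only [coverOf, Finset.coe_filter, Set.mem_ofPred_eq, Finset.mem_univ, true_and]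
  rw [← e, bitAt_encodeVertexSet, if_pos hv']
  exact one_ne_zero

/-- The cover has at most `r * (opt + 1 / C)` vertices. The error `r / C` is at most `ε`, which
suffices if `opt` is positive, and less than one, which suffices if `opt` is zero. -/
theorem card_coverOf_le (hC : 2 ≤ C) {r ε : ℝ} (hr : 0 ≤ r) (hrC : r < C) (hε : r ≤ ε * C)
    (G : FiniteGraph) {M : Finset (Fin (gridReduction C G).order)}
    (hM : (M.card : ℝ) ≤ r * megSetProblem.opt (gridReduction C G)) :
    ((coverOf (encodeVertexSet M) G.order (C * (G.order + 1))).card : ℝ) ≤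
      (r + ε) * vertexCoverProblem.opt G := by
  have hn : 0 < G.order + 1 := by omega
  have hopt := opt_gridReduction_le (C := C) G
  obtain ⟨-, hb⟩ := bestCopy_spec (w := encodeVertexSet M) (n := G.order)
    (t := C * (G.order + 1)) (by positivity) (by simp [encodeVertexSet, gridReduction])
  have hlen : (encodeVertexSet M).length = (gridReduction C G).order := by simp [encodeVertexSet]
  rw [← card_coverOf, hlen, sum_bitAt_encodeVertexSet] at hb
  generalize (coverOf (encodeVertexSet M) G.order (C * (G.order + 1))).card = b at hb ⊢
  generalize vertexCoverProblem.opt G = s at hopt ⊢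
  generalize megSetProblem.opt (gridReduction C G) = o at hopt hM
  generalize M.card = m at hb hM
  have hC' : (2 : ℝ) ≤ C := by exact_mod_cast hC
  have hopt' : (o : ℝ) ≤ s * (C * (G.order + 1) * (C * (G.order + 1))) +
      (G.order * (C * (G.order + 1)) + C * (G.order + 1)) := by exact_mod_cast hopt
  have hb' : (C * (G.order + 1) * (C * (G.order + 1)) * b : ℝ) ≤ m := by exact_mod_cast hb
  have hN : (0 : ℝ) < G.order + 1 := by positivity
  -- with side `t = C * (n + 1)` there are `n * t + t = t ^ 2 / C` rows and hubs, `1 / C` per copy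
  have key : (C * b : ℝ) ≤ r * (C * s + 1) := by
    have h₁ : (C * (G.order + 1) * (G.order + 1) : ℝ) * (C * b) ≤
        (C * (G.order + 1) * (G.order + 1)) * (r * (C * s + 1)) := by
      have := mul_le_mul_of_nonneg_left hopt' hr
      nlinarith
    exact le_of_mul_le_mul_left h₁ (by positivity)
  rcases Nat.eq_zero_or_pos s with rfl | hs
  · have hb0 : b = 0 := by
      by_contra hb0
      have : (1 : ℝ) ≤ b := by exact_mod_cast Nat.one_le_iff_ne_zero.2 hb0
      push_cast at key
      nlinarith
    simp [hb0]
  · have hs' : (1 : ℝ) ≤ s := by exact_mod_cast hs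
    have hε0 : 0 ≤ ε := by
      by_contra h
      nlinarith
    have h₂ : (C * b : ℝ) ≤ C * ((r + ε) * s) := by
      have h₃ : ε * C ≤ ε * C * s := le_mul_of_one_le_right (by positivity) hs'
      nlinarith
    exact le_of_mul_le_mul_left h₂ (by linarith)

end Approximation

end MEG

theorem mainTheorem2 (r : ℝ) (hr : 1 < r)
    (A : (G : MEG.megSetProblem.Input) → Finset (Fin G.val.order))
    (hA : MEG.IsPolyTimeApproxAlgorithm MEG.megSetProblem r A)
    (ε : ℝ) (hε : 0 < ε) :
    ∃ B : (H : MEG.vertexCoverProblem.Input) → Finset (Fin H.val.order),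
      MEG.IsPolyTimeApproxAlgorithm MEG.vertexCoverProblem (r + ε) B := by
  obtain ⟨C₀, hC₀⟩ := exists_nat_gt (max r (r / ε))
  -- `C > r` and `C ≥ r / ε` bound the error of the ratio; `C ≥ 2` is needed for rerouting
  let C := C₀ + 2
  have hC : 2 ≤ C := by omega
  have hCC : (C₀ : ℝ) ≤ C := by exact_mod_cast (by omega : C₀ ≤ C)
  have hrC : r < C := ((le_max_left _ _).trans_lt hC₀).trans_le hCC
  have hεC : r ≤ ε * C := by
    have := ((le_max_right _ _).trans_lt hC₀).trans_le hCC
    rw [div_lt_iff₀ hε] at this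
    linarith
  let R : MEG.vertexCoverProblem.Input → MEG.megSetProblem.Input := fun H =>
    ⟨MEG.gridReduction C H.val, MEG.gridReduction_connected (by omega) H.val⟩
  refine ⟨fun H => MEG.coverOf (MEG.encodeVertexSet (A (R H))) H.val.order
    (C * (H.val.order + 1)), ?_, ?_, ?_⟩
  · obtain ⟨h₁⟩ := MEG.nonempty_polyTime_gridReduction (C := C) (by omega)
    obtain ⟨h₂⟩ := hA.polyTime
    obtain ⟨h₃⟩ := MEG.nonempty_polyTime_coverOf (C := C) (by omega)
      (fun H => MEG.encodeVertexSet (A (R H))) (fun H => H.val.order)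
      (fun H => by simp [MEG.encodeVertexSet, R, MEG.gridReduction])
    obtain ⟨h₁₂⟩ := (h₁.restrict fun H : MEG.vertexCoverProblem.Input => H.val).nonempty_comp
      (h₂.restrict R)
    exact h₁₂.nonempty_comp h₃
  · exact fun H => MEG.isVertexCover_coverOf hC H.val (hA.feasible (R H))
  · exact fun H => MEG.card_coverOf_le hC (by linarith) hrC hεC H.val (hA.ratio (R H))
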